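/- **Setting.** Let $\mathbf Y$ be a real Banach space and let $\mathbf V\subset\mathbf Y$ be a separable, reflexive Banach space that is compactly embedded in $\mathbf Y$. For each $y\in\mathbf Y$ let $g_y$ be a symmetric bilinear form on $\mathbf V$ such that, for constants $c^\ast>0$ and $C^\ast<\infty$ and a strictly increasing continuous function $\beta:[0,\infty)\to\mathbb R$ with $\beta(0)=0$, $$c^\ast\|v\|_{\mathbf V}^2\le g_y(v,v)\le C^\ast\|v\|_{\mathbf V}^2,\qquad |g_y(v,v)-g_z(v,v)|\le\beta(\|y-z\|_{\mathbf Y})\,\|v\|_{\mathbf V}^2\qquad(y,z\in\mathbf Y,\ v\in\mathbf V).$$ Fix $x_A\in\mathbf Y$ and put $\mathcal M=x_A+\mathbf V$. For $a,b\in\mathcal M$, a path from $a$ to $b$ is a map $x:[0,1]\to\mathcal M$ with $x(0)=a$, $x(1)=b$ and $x(t)=x(0)+\int_0^t\dot x(s)\,ds$ for some $\dot x\in L^2((0,1);\mathbf V)$; its energy is $\mathcal E[x]=\int_0^1 g_{x(t)}(\dot x(t),\dot x(t))\,dt$; a continuous geodesic from $a$ to $b$ is a path of least energy among all paths from $a$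 to $b$; and $\mathrm{dist}(a,b)$ is the square root of the infimum of the energies of these paths. If there is exactly one continuous geodesic $x$ from $a$ to $b$, then $\log_a b:=\dot x(0)\in\mathbf V$, the derivative at $t=0$ of $t\mapsto x(t)-x(0)$ in the norm of $\mathbf V$ (whenever it exists). Let $\mathcal W:\mathbf Y\times\mathbf Y\to\mathbb R\cup\{\infty\}$ be lower semicontinuous and such that, on $\mathcal M\times\mathcal M$, $\mathcal W[a,b]=\mathrm{dist}^2(a,b)+O(\mathrm{dist}^3(a,b))$ as $\mathrm{dist}(a,b)\to0$, with uniform constants (there are $C$ and $\delta>0$ with $|\mathcal W[a,b]-\mathrm{dist}^2(a,b)|\le C\,\mathrm{dist}^3(a,b)$ whenever $\mathrm{dist}(a,b)\le\delta$), and $\mathcal W[a,b]\ge\gamma(\mathrm{dist}(a,b))$ for a strictly increasing continuous function $\gamma:[0,\infty)\to\mathbb R$ with $\gamma(0)=0$. A discrete geodesic of order $K\ge1$ from $a$ to $b$ is a minimizer $(x_0,\dots,x_K)$ of the discrete energy $K\sum_{k=1}^K\mathcal W[x_{k-1},x_k]$ among all $(K+1)$-tuples of points of $\mathcal M$ with $x_0=a$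 and $x_K=b$. If there is exactly one, then the discrete logarithm is $\left(\tfrac1K\mathrm{LOG}\right)_a(b):=x_1-x_0\in\mathbf V$, where $\tfrac1K$ is part of the symbol. **Theorem.** Assume * (H1) $y\mapsto g_y$ is of class $C^2$ from $\mathbf Y$ to the bounded bilinear forms on $\mathbf V$; * (H2) $\mathcal W$ is finite and of class $C^4$ on $(x_A+\mathbf V)\times(x_A+\mathbf V)$ with respect to the norm of $\mathbf V$, and its derivatives of order $1,\dots,4$ are bounded on bounded sets. Let $x,\tilde x\in\mathcal M$ be such that there is at most one continuous geodesic from $x$ to $\tilde x$ and, for all sufficiently large $K$, at most one discrete geodesic of order $K$ from $x$ to $\tilde x$. Then $\log_x\tilde x$ exists, $\left(\tfrac1K\mathrm{LOG}\right)_x(\tilde x)$ exists for all sufficiently large $K$, and, as $K\to\infty$, $$K\left(\tfrac1K\mathrm{LOG}\right)_x(\tilde x)\to\log_x\tilde x\quad\text{weakly in }\mathbf V\text{ and strongly in }\mathbf Y.$$ -/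

import Mathlib

open Set Filter Topology MeasureTheory

namespace GeodesicCalculus

variable {V Y : Type*} [NormedAddCommGroup V] [NormedSpace ℝ V]
  [NormedAddCommGroup Y] [NormedSpace ℝ Y]

/-- Reflexivity of a normed space: the canonical map into the bidual is onto. -/
def IsReflexive (V : Type*) [NormedAddCommGroup V] [NormedSpace ℝ V] : Prop :=
  Function.Surjective (NormedSpace.inclusionInDoubleDual ℝ V)

/-- `ι : V → Y` is a compact embedding of `V` into `Y`. -/
structure IsCompactEmbedding (ι : V →L[ℝ] Y) : Prop where
  injective : Function.Injective ι
  compact : IsCompactOperator ι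

/-- The manifold `xA + V`, as a subset of `Y`. -/
def manifold (ι : V →L[ℝ] Y) (xA : Y) : Set Y := {y | ∃ v : V, y = xA + ι v}

/-- The standing assumptions on the metric `g`.  For `y ∈ Y` the (extended) quadratic form `g y` is
finite exactly on `V`, hence it is recorded as a bilinear form on `V`. -/
structure IsAdmissibleMetric (g : Y → V →L[ℝ] V →L[ℝ] ℝ) : Prop where
  symm : ∀ y v w, g y v w = g y w v
  bounds : ∃ c C : ℝ, 0 < c ∧ ∀ y v, c * ‖v‖ ^ 2 ≤ g y v v ∧ g y v v ≤ C * ‖v‖ ^ 2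
  modulus : ∃ β : ℝ → ℝ, StrictMonoOn β (Ici 0) ∧ ContinuousOn β (Ici 0) ∧ β 0 = 0 ∧
    ∀ y z v, |g y v v - g z v v| ≤ β ‖y - z‖ * ‖v‖ ^ 2

/-- `x : [0,1] → Y` is a `W^{1,2}` path in a translate of `V`, with velocity `v ∈ L²((0,1);V)`.
Only the values of `x` and `v` on `[0,1]` are relevant. -/
def IsSobolevPath (ι : V →L[ℝ] Y) (x : ℝ → Y) (v : ℝ → V) : Prop :=
  MemLp v 2 (volume.restrict (Icc (0 : ℝ) 1)) ∧
    ∀ t ∈ Icc (0 : ℝ) 1, x t = x 0 + ι (∫ s in (0 : ℝ)..t, v s)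

/-- A `W^{1,2}` path `x` with velocity `v` joining `a` to `b`. -/
def IsPathBetween (ι : V →L[ℝ] Y) (a b : Y) (x : ℝ → Y) (v : ℝ → V) : Prop :=
  IsSobolevPath ι x v ∧ x 0 = a ∧ x 1 = b

/-- The path energy `∫₀¹ g_{x(t)}(ẋ(t), ẋ(t)) dt`. -/
noncomputable def pathEnergy (g : Y → V →L[ℝ] V →L[ℝ] ℝ) (x : ℝ → Y) (v : ℝ → V) : ℝ :=
  ∫ t in (0 : ℝ)..1, g (x t) (v t) (v t)

/-- The Riemannian distance: the square root of the least path energy.  It is only used for points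
that differ by an element of `V`; these are joined by paths of finite energy. -/
noncomputable def riemDist (ι : V →L[ℝ] Y) (g : Y → V →L[ℝ] V →L[ℝ] ℝ) (a b : Y) : ℝ :=
  √(sInf {E : ℝ | ∃ x v, IsPathBetween ι a b x v ∧ E = pathEnergy g x v})

/-- A continuous geodesic from `a` to `b`: a path of least energy among all paths from `a` to `b`. -/
def IsGeodesic (ι : V →L[ℝ] Y) (g : Y → V →L[ℝ] V →L[ℝ] ℝ) (a b : Y)
    (x : ℝ → Y) (v : ℝ → V) : Prop :=
  IsPathBetween ι a b x v ∧
    ∀ x' v', IsPathBetween ι a b x' v' → pathEnergy g x v ≤ pathEnergy g x' v'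

/-- There is at most one continuous geodesic from `a` to `b`. -/
def GeodesicsUnique (ι : V →L[ℝ] Y) (g : Y → V →L[ℝ] V →L[ℝ] ℝ) (a b : Y) : Prop :=
  ∀ x v x' v', IsGeodesic ι g a b x v → IsGeodesic ι g a b x' v' → EqOn x x' (Icc 0 1)

/-- `ℓ = log_a b`: there is exactly one continuous geodesic from `a` to `b`, and `ℓ ∈ V` is its
initial velocity, the derivative at `t = 0`, in the norm of `V`, of the displacement
`x(t) - x(0) = ∫₀ᵗ v`. -/
def IsLog (ι : V →L[ℝ] Y) (g : Y → V →L[ℝ] V →L[ℝ] ℝ) (a b : Y) (ℓ : V) : Prop :=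
  GeodesicsUnique ι g a b ∧ ∃ x v, IsGeodesic ι g a b x v ∧
    HasDerivWithinAt (fun t : ℝ => ∫ s in (0 : ℝ)..t, v s) ℓ (Icc 0 1) 0

/-- The standing assumptions on the functional `W : Y × Y → ℝ ∪ {∞}` on the manifold `xA + V`:
lower semicontinuity, `W = dist² + O(dist³)` with uniform constants, and coercivity. -/
structure IsAdmissibleEnergy (ι : V →L[ℝ] Y) (g : Y → V →L[ℝ] V →L[ℝ] ℝ) (xA : Y)
    (W : Y → Y → EReal) : Prop where
  ne_bot : ∀ a b, W a b ≠ ⊥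
  lsc : LowerSemicontinuous fun p : Y × Y => W p.1 p.2
  approx : ∃ C δ : ℝ, 0 < δ ∧ ∀ a ∈ manifold ι xA, ∀ b ∈ manifold ι xA, riemDist ι g a b ≤ δ →
    ((riemDist ι g a b ^ 2 - C * riemDist ι g a b ^ 3 : ℝ) : EReal) ≤ W a b ∧
      W a b ≤ ((riemDist ι g a b ^ 2 + C * riemDist ι g a b ^ 3 : ℝ) : EReal)
  coercive : ∃ γ : ℝ → ℝ, StrictMonoOn γ (Ici 0) ∧ ContinuousOn γ (Ici 0) ∧ γ 0 = 0 ∧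
    ∀ a ∈ manifold ι xA, ∀ b ∈ manifold ι xA, ((γ (riemDist ι g a b) : ℝ) : EReal) ≤ W a b

/-- `W` is finite and of class `C⁴` on `(xA + V) × (xA + V)`, in the norm of `V`, and its
derivatives of order one to four are bounded on bounded sets. -/
def IsSmoothEnergy (ι : V →L[ℝ] Y) (xA : Y) (W : Y → Y → EReal) : Prop :=
  ∃ w : V × V → ℝ, (∀ p : V × V, W (xA + ι p.1) (xA + ι p.2) = ((w p : ℝ) : EReal)) ∧
    ContDiff ℝ 4 w ∧
    ∀ B : Set (V × V), Bornology.IsBounded B → ∀ k ∈ Finset.Icc 1 4,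
      ∃ M : ℝ, ∀ p ∈ B, ‖iteratedFDeriv ℝ k w p‖ ≤ M

/-- The discrete path energy `K ∑ₖ W[xₖ₋₁, xₖ]` of a discrete `K`-path. -/
noncomputable def discreteEnergy (W : Y → Y → EReal) {K : ℕ} (p : Fin (K + 1) → Y) : EReal :=
  ((K : ℝ) : EReal) * ∑ k : Fin K, W (p k.castSucc) (p k.succ)

/-- A discrete `K`-path on the manifold `xA + V` from `a` to `b`. -/
def IsDiscretePath (ι : V →L[ℝ] Y) (xA : Y) {K : ℕ} (a b : Y) (p : Fin (K + 1) → Y) : Prop :=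
  (∀ k, p k ∈ manifold ι xA) ∧ p 0 = a ∧ p (Fin.last K) = b

/-- A discrete geodesic of order `K` from `a` to `b`: a minimizer of the discrete path energy. -/
def IsDiscreteGeodesic (ι : V →L[ℝ] Y) (xA : Y) (W : Y → Y → EReal) {K : ℕ} (a b : Y)
    (p : Fin (K + 1) → Y) : Prop :=
  IsDiscretePath ι xA a b p ∧
    ∀ q : Fin (K + 1) → Y, IsDiscretePath ι xA a b q → discreteEnergy W p ≤ discreteEnergy W q

/-- There is at most one discrete geodesic of order `K` from `a` to `b`. -/
def DiscreteGeodesicsUnique (ι : V →L[ℝ] Y) (xA : Y) (W : Y → Y → EReal) (K : ℕ) (a b : Y) : Prop :=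
  ∀ p q : Fin (K + 1) → Y,
    IsDiscreteGeodesic ι xA W a b p → IsDiscreteGeodesic ι xA W a b q → p = q

/-- `ζ = (1/K LOG)_a(b)`: there is exactly one discrete geodesic `(x₀, …, x_K)` of order `K` from
`a` to `b`, and `x₁ - x₀ = ζ ∈ V`. -/
def IsDiscreteLog (ι : V →L[ℝ] Y) (xA : Y) (W : Y → Y → EReal) (K : ℕ) (a b : Y) (ζ : V) : Prop :=
  DiscreteGeodesicsUnique ι xA W K a b ∧ ∃ p : Fin (K + 1) → Y,
    IsDiscreteGeodesic ι xA W a b p ∧ p 1 - p 0 = ι ζ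

end GeodesicCalculus

/-!
The theorem is proved by showing that discrete geodesics are compact in a weak `C¹` sense, which makes
the regularity theory of continuous geodesics unnecessary.

Write points of `xA + V` in the coordinates of `V`, so that `W` becomes a smooth function `w` on
`V × V`, and let `a k = K (u (k + 1) - u k)` be the velocity of a discrete geodesic `u` of order `K`.

* Bounds. `w` is nonnegative and vanishes on the diagonal, hence so does its derivative, and its
  Hessian there is determined by one coercive form. The discrete Euler–Lagrange equation then reads
  `‖a (k + 1) - a k‖ ≤ (M / K) (‖a k‖² + ‖a (k + 1)‖²)`
  (`IsTwoPointEnergy.exists_norm_increment_sub_le`). The energy bounds the mean of `‖a k‖²`, so `a`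
  has bounded variation, hence is bounded, hence is Lipschitz in `k / K` with a constant that does
  not depend on `K` (`IsTwoPointEnergy.exists_velocity_bounds`).
* Compactness. Along an ultrafilter finer than `atTop`, velocities and positions at time `t` converge
  weakly to some `v t` and `X t`. The Lipschitz bound gives
  `‖X t - X s - (t - s) v s‖ ≤ L (t - s)²` in the limit, so that `X` is continuously differentiable
  with derivative `v` (`exists_limit_path`). No subsequences have to be extracted.
* Minimality. `W` is bounded below by `(1 - ε) g` near the diagonal
  (`IsAdmissibleEnergy.exists_le`), and `g` is weakly lower semicontinuous uniformly in time
  (`eventually_density_le`), so the energy of `X` is at most the limit of the discrete energies. In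
  turn these are asymptotically at most the energy of any path, by sampling it at `k / K`
  (`IsPathBetween.eventually_discrete_le`). Hence `X` is a geodesic, whose initial velocity `v 0` is
  the weak limit of `a 0` (`exists_isGeodesic_of_ultrafilter`).

Uniqueness of the geodesic shows that `v 0` is the same for all ultrafilters, which gives the weak
convergence along `atTop`; strong convergence in `Y` follows as the embedding is compact.
-/

namespace GeodesicCalculus

-- many lemmas share the variables of their part without needing all of them
set_option linter.unusedSectionVars false

/-! ### Weak limits along ultrafilters -/

section

variable {V Y : Type*} [NormedAddCommGroup V] [NormedSpace ℝ V]
  [NormedAddCommGroup Y] [NormedSpace ℝ Y]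

/-- Weak convergence in `V` of `f` along the filter `l` to `v`. -/
def WeakTendsto {α : Type*} (f : α → V) (l : Filter α) (v : V) : Prop :=
  ∀ φ : StrongDual ℝ V, Tendsto (fun i => φ (f i)) l (𝓝 (φ v))

namespace WeakTendsto

variable {α : Type*} {f f' : α → V} {l : Filter α} {v v' : V}

lemma sub (h : WeakTendsto f l v) (h' : WeakTendsto f' l v') :
    WeakTendsto (fun i => f i - f' i) l (v - v') := fun φ => by
  simpa using (h φ).sub (h' φ)

lemma const_smul (h : WeakTendsto f l v) (r : ℝ) :
    WeakTendsto (fun i => r • f i) l (r • v) := fun φ => by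
  simpa using (h φ).const_mul r

lemma unique [l.NeBot] (h : WeakTendsto f l v) (h' : WeakTendsto f l v') : v = v' :=
  (SeparatingDual.eq_iff_forall_dual_eq (R := ℝ)).2 fun φ => tendsto_nhds_unique (h φ) (h' φ)

/-- The norm is weakly lower semicontinuous. -/
lemma norm_le [l.NeBot] (h : WeakTendsto f l v) {b : α → ℝ} {B : ℝ}
    (hb : Tendsto b l (𝓝 B)) (hf : ∀ᶠ i in l, ‖f i‖ ≤ b i) : ‖v‖ ≤ B := by
  obtain ⟨φ, hφ, hφv⟩ := exists_dual_vector'' ℝ v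
  have h1 : Tendsto (fun i => φ (f i)) l (𝓝 ‖v‖) := by simpa [hφv] using h φ
  refine le_of_tendsto_of_tendsto h1 hb ?_
  filter_upwards [hf] with i hi
  calc φ (f i) ≤ ‖φ (f i)‖ := Real.le_norm_self _
    _ ≤ ‖φ‖ * ‖f i‖ := φ.le_opNorm _
    _ ≤ 1 * ‖f i‖ := by gcongr
    _ ≤ b i := by simpa using hi

lemma congr_of_norm_sub (h : WeakTendsto f l v) {b : α → ℝ} (hb : Tendsto b l (𝓝 0))
    (hf : ∀ᶠ i in l, ‖f' i - f i‖ ≤ b i) : WeakTendsto f' l v := fun φ => by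
  have h1 : Tendsto (fun i => φ (f' i) - φ (f i)) l (𝓝 0) := by
    refine squeeze_zero_norm' (a := fun i => ‖φ‖ * b i) ?_ (by simpa using hb.const_mul ‖φ‖)
    filter_upwards [hf] with i hi
    rw [← map_sub]
    exact (φ.le_opNorm _).trans (by gcongr)
  simpa using h1.add (h φ)

/-- A compact operator maps weakly convergent bounded families to norm convergent ones; for
ultrafilters no subsequence argument is needed. -/
lemma tendsto_of_isCompactOperator {U : Ultrafilter α} (h : WeakTendsto f U v)
    {T : V →L[ℝ] Y} (hT : IsCompactOperator T) {R : ℝ} (hf : ∀ᶠ i in U, ‖f i‖ ≤ R) :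
    Tendsto (fun i => T (f i)) U (𝓝 (T v)) := by
  obtain ⟨S, hS, hsub⟩ := IsCompactOperator.image_closedBall_subset_compact (f := (T : V →ₗ[ℝ] Y)) hT R
  have hmem : ∀ᶠ i in U, T (f i) ∈ S := by
    filter_upwards [hf] with i hi
    exact hsub ⟨f i, by simpa using hi, rfl⟩
  obtain ⟨y, -, hy⟩ := hS.ultrafilter_le_nhds (U.map fun i => T (f i))
    (le_principal_iff.2 hmem)
  have hy' : Tendsto (fun i => T (f i)) U (𝓝 y) := hy
  have : y = T v := (SeparatingDual.eq_iff_forall_dual_eq (R := ℝ)).2 fun ψ =>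
    tendsto_nhds_unique ((ψ.continuous.tendsto y).comp hy') (h (ψ.comp T))
  exact this ▸ hy'

end WeakTendsto

/-- Bounded families in a reflexive space converge weakly along every ultrafilter. -/
lemma IsReflexive.exists_weakTendsto (hV : IsReflexive V) {α : Type*} (U : Ultrafilter α)
    {f : α → V} {R : ℝ} (hf : ∀ᶠ i in U, ‖f i‖ ≤ R) : ∃ v, WeakTendsto f U v := by
  have hlim : ∀ φ : StrongDual ℝ V, ∃ y : ℝ, Tendsto (fun i => φ (f i)) U (𝓝 y) := fun φ => by
    have hmem : ∀ᶠ i in U, φ (f i) ∈ Metric.closedBall (0 : ℝ) (‖φ‖ * R) := by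
      filter_upwards [hf] with i hi
      simpa using (φ.le_opNorm (f i)).trans (by gcongr)
    obtain ⟨y, -, hy⟩ := (isCompact_closedBall (0 : ℝ) (‖φ‖ * R)).ultrafilter_le_nhds
      (U.map fun i => φ (f i)) (le_principal_iff.2 hmem)
    exact ⟨y, hy⟩
  choose y hy using hlim
  let Λ : StrongDual ℝ V →ₗ[ℝ] ℝ :=
    { toFun := y
      map_add' := fun φ ψ => tendsto_nhds_unique (hy (φ + ψ)) (by simpa using (hy φ).add (hy ψ))
      map_smul' := fun r φ =>
        tendsto_nhds_unique (hy (r • φ)) (by simpa using (hy φ).const_mul r) }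
  obtain ⟨v, hv⟩ := hV (Λ.mkContinuous R fun φ => by
    refine le_of_tendsto (hy φ).norm ?_
    filter_upwards [hf] with i hi
    rw [mul_comm]
    exact (φ.le_opNorm (f i)).trans (by gcongr))
  refine ⟨v, fun φ => ?_⟩
  have : φ v = y φ := by
    exact congrArg (fun F => F φ) hv
  rw [this]
  exact hy φ

/-- A compact operator on a reflexive space maps closed balls onto compact sets. -/
lemma IsReflexive.isCompact_image_closedBall (hV : IsReflexive V) {T : V →L[ℝ] Y}
    (hT : IsCompactOperator T) (R : ℝ) : IsCompact (T '' Metric.closedBall 0 R) := by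
  rw [isCompact_iff_ultrafilter_le_nhds]
  intro U hU
  have hU' : ∀ᶠ y in (U : Filter Y), ∃ v : V, ‖v‖ ≤ R ∧ T v = y := by
    have h0 : T '' Metric.closedBall 0 R ∈ (U : Filter Y) := le_principal_iff.1 hU
    filter_upwards [h0] with y hy
    obtain ⟨v, hv, rfl⟩ := hy
    exact ⟨v, by simpa using hv, rfl⟩
  classical
  choose! s hs using fun (y : Y) (h : ∃ v : V, ‖v‖ ≤ R ∧ T v = y) => h
  have hb : ∀ᶠ y in (U : Filter Y), ‖s y‖ ≤ R := hU'.mono fun y hy => (hs y hy).1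
  obtain ⟨v, hv⟩ := hV.exists_weakTendsto U hb
  refine ⟨T v, ⟨v, by simpa using hv.norm_le tendsto_const_nhds hb, rfl⟩, ?_⟩
  have h1 := hv.tendsto_of_isCompactOperator hT hb
  have h2 : Tendsto (fun y : Y => y) U (𝓝 (T v)) :=
    h1.congr' (hU'.mono fun y hy => (hs y hy).2)
  exact h2

end

/-! ### Sobolev paths, their energy, and the distance -/

section

variable {V Y : Type*} [NormedAddCommGroup V] [NormedSpace ℝ V]
  [NormedAddCommGroup Y] [NormedSpace ℝ Y]

variable {ι : V →L[ℝ] Y} {g : Y → V →L[ℝ] V →L[ℝ] ℝ} {x : ℝ → Y} {v : ℝ → V} {a b : Y}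

lemma IsAdmissibleMetric.nonneg (hg : IsAdmissibleMetric g) (y : Y) (v : V) : 0 ≤ g y v v := by
  obtain ⟨c, C, hc, h⟩ := hg.bounds
  exact le_trans (by positivity) (h y v).1

lemma integrableOn_comp_affine {E : Type*} [NormedAddCommGroup E] {f : ℝ → E} {s t : ℝ}
    (hst : s < t) (hf : IntervalIntegrable f volume s t) :
    IntegrableOn (fun r => f ((t - s) * r + s)) (Icc 0 1) := by
  have h1 := (hf.comp_add_right s).comp_mul_left (c := t - s)
  rw [sub_self, zero_div, div_self (sub_pos.2 hst).ne'] at h1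
  exact (intervalIntegrable_iff_integrableOn_Icc_of_le zero_le_one).1 h1

namespace IsSobolevPath

lemma integrableOn (h : IsSobolevPath ι x v) : IntegrableOn v (Icc 0 1) :=
  h.1.integrable (by norm_num)

lemma intervalIntegrable (h : IsSobolevPath ι x v) {s t : ℝ} (hs : s ∈ Icc (0 : ℝ) 1)
    (ht : t ∈ Icc (0 : ℝ) 1) : IntervalIntegrable v volume s t :=
  (h.integrableOn.mono_set (uIcc_subset_Icc hs ht)).intervalIntegrable

lemma integrableOn_norm_sq (h : IsSobolevPath ι x v) :
    IntegrableOn (fun t => ‖v t‖ ^ 2) (Icc 0 1) :=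
  h.1.integrable_norm_pow (p := 2) (by norm_num)

lemma continuousOn (h : IsSobolevPath ι x v) : ContinuousOn x (Icc 0 1) := by
  have h1 : ContinuousOn (fun t => ∫ s in (0 : ℝ)..t, v s) (Icc 0 1) := by
    have := intervalIntegral.continuousOn_primitive_interval (a := 0) (b := 1) (f := v)
      (μ := volume) (by simpa [uIcc_of_le] using h.integrableOn)
    simpa [uIcc_of_le] using this
  exact (continuousOn_const.add (ι.continuous.comp_continuousOn h1)).congr h.2

lemma integrableOn_energy (h : IsSobolevPath ι x v) (hg : IsAdmissibleMetric g)
    (hgc : Continuous g) : IntegrableOn (fun t => g (x t) (v t) (v t)) (Icc 0 1) := by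
  obtain ⟨c, C, hc, hb⟩ := hg.bounds
  refine (h.integrableOn_norm_sq.const_mul C).mono' ?_ ?_
  · have h1 : AEStronglyMeasurable (fun t => g (x t)) (volume.restrict (Icc 0 1)) :=
      hgc.comp_aestronglyMeasurable (h.continuousOn.aestronglyMeasurable measurableSet_Icc)
    have h2 : AEStronglyMeasurable (fun t => g (x t) (v t)) (volume.restrict (Icc 0 1)) :=
      Continuous.comp_aestronglyMeasurable₂ (g := fun (A : V →L[ℝ] V →L[ℝ] ℝ) (u : V) => A u)
        isBoundedBilinearMap_apply.continuous h1 h.1.1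
    exact Continuous.comp_aestronglyMeasurable₂ (g := fun (A : V →L[ℝ] ℝ) (u : V) => A u)
        isBoundedBilinearMap_apply.continuous h2 h.1.1
  · refine Eventually.of_forall fun t => ?_
    rw [Real.norm_of_nonneg (hg.nonneg _ _)]
    exact (hb _ _).2

lemma intervalIntegrable_energy (h : IsSobolevPath ι x v) (hg : IsAdmissibleMetric g)
    (hgc : Continuous g) {s t : ℝ} (hs : s ∈ Icc (0 : ℝ) 1) (ht : t ∈ Icc (0 : ℝ) 1) :
    IntervalIntegrable (fun t => g (x t) (v t) (v t)) volume s t :=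
  ((h.integrableOn_energy hg hgc).mono_set (uIcc_subset_Icc hs ht)).intervalIntegrable

lemma sub_eq (h : IsSobolevPath ι x v) {s t : ℝ} (hs : s ∈ Icc (0 : ℝ) 1)
    (ht : t ∈ Icc (0 : ℝ) 1) : x t = x s + ι (∫ r in s..t, v r) := by
  have h0 : (0 : ℝ) ∈ Icc (0 : ℝ) 1 := by simp
  rw [h.2 t ht, h.2 s hs, ← intervalIntegral.integral_add_adjacent_intervals
    (h.intervalIntegrable h0 hs) (h.intervalIntegrable hs ht), map_add, add_assoc]

/-- The restriction of a path to `[s, t]`, reparametrized over `[0, 1]`. -/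
lemma isPathBetween_restrict (h : IsSobolevPath ι x v) {s t : ℝ} (hs : s ∈ Icc (0 : ℝ) 1)
    (ht : t ∈ Icc (0 : ℝ) 1) (hst : s < t) :
    IsPathBetween ι (x s) (x t) (fun r => x ((t - s) * r + s))
      (fun r => (t - s) • v ((t - s) * r + s)) := by
  have hpos : 0 < t - s := sub_pos.2 hst
  have hmem : ∀ r ∈ Icc (0 : ℝ) 1, (t - s) * r + s ∈ Icc (0 : ℝ) 1 := by
    intro r hr
    constructor <;> nlinarith [hr.1, hr.2, hs.1, ht.2]
  refine ⟨⟨?_, ?_⟩, by simp, by simp⟩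
  · have hm := (integrableOn_comp_affine hst (h.intervalIntegrable hs ht)).1
    refine ((memLp_two_iff_integrable_sq_norm hm).2 ?_).const_smul (t - s)
    exact integrableOn_comp_affine hst ((h.integrableOn_norm_sq.mono_set (uIcc_subset_Icc hs ht)).intervalIntegrable)
  · intro r hr
    simp only [mul_zero, zero_add]
    rw [h.sub_eq hs (hmem r hr), intervalIntegral.integral_smul,
      intervalIntegral.smul_integral_comp_mul_add]
    simp

lemma pathEnergy_restrict (s t : ℝ) :
    pathEnergy g (fun r => x ((t - s) * r + s)) (fun r => (t - s) • v ((t - s) * r + s)) =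
      (t - s) * ∫ r in s..t, g (x r) (v r) (v r) := by
  have := intervalIntegral.smul_integral_comp_mul_add (a := 0) (b := 1)
    (fun r => g (x r) (v r) (v r)) (t - s) s
  simp only [mul_zero, zero_add, mul_one, sub_add_cancel, smul_eq_mul] at this
  rw [← this]
  simp [pathEnergy]

end IsSobolevPath

lemma IsAdmissibleMetric.pathEnergy_nonneg (hg : IsAdmissibleMetric g) (x : ℝ → Y) (v : ℝ → V) :
    0 ≤ pathEnergy g x v :=
  intervalIntegral.integral_nonneg zero_le_one fun _ _ => hg.nonneg _ _

lemma IsAdmissibleMetric.riemDist_sq (hg : IsAdmissibleMetric g) (a b : Y) :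
    riemDist ι g a b ^ 2 =
      sInf {E : ℝ | ∃ x v, IsPathBetween ι a b x v ∧ E = pathEnergy g x v} := by
  refine Real.sq_sqrt (Real.sInf_nonneg ?_)
  rintro _ ⟨x, v, -, rfl⟩
  exact hg.pathEnergy_nonneg x v

lemma riemDist_nonneg (a b : Y) : 0 ≤ riemDist ι g a b := Real.sqrt_nonneg _

lemma IsPathBetween.riemDist_sq_le (h : IsPathBetween ι a b x v) (hg : IsAdmissibleMetric g) :
    riemDist ι g a b ^ 2 ≤ pathEnergy g x v := by
  rw [hg.riemDist_sq]
  refine csInf_le ⟨0, ?_⟩ ⟨x, v, h, rfl⟩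
  rintro _ ⟨x, v, -, rfl⟩
  exact hg.pathEnergy_nonneg x v

lemma isPathBetween_segment [CompleteSpace V] (y : Y) (m : V) :
    IsPathBetween ι y (y + ι m) (fun t => y + t • ι m) (fun _ => m) := by
  refine ⟨⟨memLp_const m, fun t _ => ?_⟩, by simp, by simp⟩
  simp

lemma IsAdmissibleMetric.riemDist_self [CompleteSpace V] (hg : IsAdmissibleMetric g) (y : Y) :
    riemDist ι g y y = 0 := by
  have h := (isPathBetween_segment (ι := ι) y 0).riemDist_sq_le hg
  simp only [map_zero, add_zero, pathEnergy, intervalIntegral.integral_zero] at h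
  exact pow_eq_zero_iff two_ne_zero |>.1 (le_antisymm h (sq_nonneg _))

lemma IsAdmissibleMetric.exists_path_of_riemDist_sq_lt [CompleteSpace V] (hg : IsAdmissibleMetric g) {y : Y} {m : V}
    {r : ℝ} (h : riemDist ι g y (y + ι m) ^ 2 < r) :
    ∃ x v, IsPathBetween ι y (y + ι m) x v ∧ pathEnergy g x v < r := by
  rw [hg.riemDist_sq] at h
  obtain ⟨_, ⟨x, v, hp, rfl⟩, hE⟩ :=
    exists_lt_of_csInf_lt (by exact ⟨_, _, _, isPathBetween_segment y m, rfl⟩) h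
  exact ⟨x, v, hp, hE⟩

lemma sq_integral_norm_le {v : ℝ → V} (h : MemLp v 2 (volume.restrict (Icc (0 : ℝ) 1))) :
    (∫ t in (0 : ℝ)..1, ‖v t‖) ^ 2 ≤ ∫ t in (0 : ℝ)..1, ‖v t‖ ^ 2 := by
  have h1 : IntervalIntegrable (fun t => ‖v t‖) volume 0 1 :=
    (intervalIntegrable_iff_integrableOn_Icc_of_le zero_le_one).2 (h.integrable (by norm_num)).norm
  have h2 : IntervalIntegrable (fun t => ‖v t‖ ^ 2) volume 0 1 :=
    (intervalIntegrable_iff_integrableOn_Icc_of_le zero_le_one).2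
      (h.integrable_norm_pow (p := 2) (by norm_num))
  set m := ∫ t in (0 : ℝ)..1, ‖v t‖ with hm
  have h3 : 0 ≤ ∫ t in (0 : ℝ)..1, (‖v t‖ ^ 2 - 2 * m * ‖v t‖ + m ^ 2) :=
    intervalIntegral.integral_nonneg zero_le_one fun t _ => by nlinarith [sq_nonneg (‖v t‖ - m)]
  rw [intervalIntegral.integral_add (h2.sub (h1.const_mul _)) intervalIntegrable_const,
    intervalIntegral.integral_sub h2 (h1.const_mul _), intervalIntegral.integral_const_mul,
    ← hm] at h3
  simp at h3
  nlinarith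

namespace IsPathBetween

/-- A path of small energy stays close to its starting point in `Y`. -/
lemma norm_sub_le [CompleteSpace V] (h : IsPathBetween ι a b x v) {c : ℝ} (hc : 0 < c)
    (hg : IsAdmissibleMetric g) (hgc : Continuous g) (hb : ∀ y v, c * ‖v‖ ^ 2 ≤ g y v v)
    {ρ : ℝ} (hρ : 0 ≤ ρ) (hE : pathEnergy g x v ≤ c * ρ ^ 2) {t : ℝ} (ht : t ∈ Icc (0 : ℝ) 1) :
    ‖x t - a‖ ≤ ‖ι‖ * ρ := by
  obtain ⟨h, rfl, -⟩ := h
  have h0 : (0 : ℝ) ∈ Icc (0 : ℝ) 1 := by simp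
  have h1' : (1 : ℝ) ∈ Icc (0 : ℝ) 1 := by simp
  have h1 : c * ∫ t in (0 : ℝ)..1, ‖v t‖ ^ 2 ≤ pathEnergy g x v := by
    rw [← intervalIntegral.integral_const_mul]
    refine intervalIntegral.integral_mono_on zero_le_one ?_
      (h.intervalIntegrable_energy hg hgc h0 h1') fun t _ => hb _ _
    exact (intervalIntegrable_iff_integrableOn_Icc_of_le zero_le_one).2
      (h.integrableOn_norm_sq.const_mul c)
  have h2 : ∫ t in (0 : ℝ)..1, ‖v t‖ ≤ ρ := by
    refine abs_le_of_sq_le_sq' ?_ hρ |>.2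
    refine (sq_integral_norm_le h.1).trans ?_
    exact le_of_mul_le_mul_left (h1.trans hE) hc
  have h3 : ‖∫ s in (0 : ℝ)..t, v s‖ ≤ ∫ t in (0 : ℝ)..1, ‖v t‖ := by
    refine (intervalIntegral.norm_integral_le_integral_norm ht.1).trans ?_
    refine intervalIntegral.integral_mono_interval le_rfl ht.1 ht.2
      (Eventually.of_forall fun _ => norm_nonneg _) (h.intervalIntegrable h0 h1').norm
  rw [h.2 t ht, add_sub_cancel_left]
  exact (ι.le_opNorm _).trans (by gcongr; exact h3.trans h2)

/-- Jensen's inequality for the frozen metric `g_a`, perturbed: if `g` changes by a factor of at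
most `1 - η` along the path, then the energy is at least `(1 - η) g_a(m, m)`, where `m` is the
displacement. -/
lemma le_pathEnergy [CompleteSpace V] (hι : Function.Injective ι) {m : V}
    (h : IsPathBetween ι a (a + ι m) x v) (hg : IsAdmissibleMetric g) (hgc : Continuous g)
    {η : ℝ} (hη : η ≤ 1)
    (hclose : ∀ t ∈ Icc (0 : ℝ) 1, ∀ u, (1 - η) * g a u u ≤ g (x t) u u) :
    (1 - η) * g a m m ≤ pathEnergy g x v := by
  obtain ⟨h, h0, h1⟩ := h
  have i0 : (0 : ℝ) ∈ Icc (0 : ℝ) 1 := by simp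
  have i1 : (1 : ℝ) ∈ Icc (0 : ℝ) 1 := by simp
  have hm : ∫ t in (0 : ℝ)..1, v t = m := by
    have := h.2 1 i1
    rw [h0, h1] at this
    exact (hι (add_left_cancel this)).symm
  have hint : ∫ t in (0 : ℝ)..1, g a m (v t) = g a m m := by
    rw [ContinuousLinearMap.intervalIntegral_comp_comm _ (h.intervalIntegrable i0 i1), hm]
  have hii : IntervalIntegrable (fun t => g a m (v t)) volume 0 1 :=
    (intervalIntegrable_iff_integrableOn_Icc_of_le zero_le_one).2
      ((g a m).integrable_comp h.integrableOn)
  have key : ∫ t in (0 : ℝ)..1, (1 - η) * (2 * g a m (v t) - g a m m) ≤ pathEnergy g x v := by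
    refine intervalIntegral.integral_mono_on zero_le_one ?_
      (h.intervalIntegrable_energy hg hgc i0 i1) fun t ht => ?_
    · exact ((hii.const_mul 2).sub intervalIntegrable_const).const_mul _
    · refine le_trans ?_ (hclose t ht (v t))
      refine mul_le_mul_of_nonneg_left ?_ (by linarith)
      have := hg.nonneg a (v t - m)
      simp only [map_sub, FunLike.coe_sub, Pi.sub_apply] at this
      rw [hg.symm a (v t) m] at this
      linarith
  rw [intervalIntegral.integral_const_mul, intervalIntegral.integral_sub (hii.const_mul 2)
    intervalIntegrable_const, intervalIntegral.integral_const_mul, hint] at key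
  simp at key
  linarith

end IsPathBetween

end

/-! ### The energy `W` compared with the metric and with sampled paths -/

section

variable {V Y : Type*} [NormedAddCommGroup V] [NormedSpace ℝ V]
  [NormedAddCommGroup Y] [NormedSpace ℝ Y]

variable {ι : V →L[ℝ] Y} {g : Y → V →L[ℝ] V →L[ℝ] ℝ} {xA : Y} {W : Y → Y → EReal}
  {w : V × V → ℝ}

/-- `riemDist` is at least the length of the displacement in the metric frozen at the initial point,
up to a factor arbitrarily close to one. -/
lemma IsAdmissibleMetric.exists_le_riemDist_sq [CompleteSpace V] (hg : IsAdmissibleMetric g)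
    (hgc : Continuous g) (hι : Function.Injective ι) {η : ℝ} (hη : 0 < η) (hη1 : η ≤ 1) :
    ∃ ρ > 0, ∀ y m, riemDist ι g y (y + ι m) < ρ →
      (1 - η) * g y m m ≤ riemDist ι g y (y + ι m) ^ 2 := by
  obtain ⟨c, _, hc, hb⟩ := hg.bounds
  obtain ⟨β, hβm, hβc, hβ0, hβ⟩ := hg.modulus
  have hb' : ∀ y v, c * ‖v‖ ^ 2 ≤ g y v v := fun y v => (hb y v).1
  obtain ⟨s, hs, hsβ⟩ : ∃ s > 0, ∀ r, 0 ≤ r → r ≤ s → β r ≤ η * c := by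
    have h1 := hβc 0 (by simp)
    have h2 : ∀ᶠ r in 𝓝[Ici 0] (0 : ℝ), β r < η * c :=
      h1.eventually_lt_const (by rw [hβ0]; positivity)
    obtain ⟨s, hs, hsub⟩ := Metric.mem_nhdsWithin_iff.1 h2
    refine ⟨s / 2, by positivity, fun r h0 hr => (hsub ⟨?_, h0⟩).le⟩
    simp only [Metric.mem_ball, dist_zero_right, Real.norm_of_nonneg h0]
    linarith
  set ρ := s / (‖ι‖ + 1) with hρ
  have hρ0 : 0 < ρ := by positivity
  have hιρ : ‖ι‖ * ρ ≤ s := by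
    rw [hρ, mul_div_assoc', div_le_iff₀ (by positivity)]
    nlinarith [norm_nonneg ι]
  have hsq : √c ^ 2 = c := Real.sq_sqrt hc.le
  refine ⟨√c * ρ, by positivity, fun y m hd => ?_⟩
  have hd2 : riemDist ι g y (y + ι m) ^ 2 < c * ρ ^ 2 := by
    rw [← hsq, ← mul_pow]
    exact pow_lt_pow_left₀ hd (riemDist_nonneg _ _) two_ne_zero
  by_contra! hlt
  obtain ⟨x, v, hp, hE⟩ := hg.exists_path_of_riemDist_sq_lt (lt_min hlt hd2)
  refine absurd (hp.le_pathEnergy hι hg hgc hη1 fun t ht u => ?_)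
    (not_le.2 (hE.trans_le (min_le_left _ _)))
  have h1 := hp.norm_sub_le hc hg hgc hb' hρ0.le (hE.le.trans (min_le_right _ _)) ht
  have h2 := hsβ _ (norm_nonneg _) (h1.trans hιρ)
  have h3 := (abs_le.1 (hβ (x t) y u)).1
  nlinarith [hb' y u, sq_nonneg ‖u‖, mul_le_mul_of_nonneg_right h2 (sq_nonneg ‖u‖)]

namespace IsAdmissibleEnergy

lemma nonneg (hW : IsAdmissibleEnergy ι g xA W)
    (hw : ∀ p : V × V, W (xA + ι p.1) (xA + ι p.2) = ((w p : ℝ) : EReal)) (p : V × V) :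
    0 ≤ w p := by
  obtain ⟨γ, hγ, -, hγ0, h⟩ := hW.coercive
  have := h (xA + ι p.1) ⟨_, rfl⟩ (xA + ι p.2) ⟨_, rfl⟩
  rw [hw, EReal.coe_le_coe_iff] at this
  refine le_trans ?_ this
  rw [← hγ0]
  exact hγ.monotoneOn self_mem_Ici (riemDist_nonneg _ _) (riemDist_nonneg _ _)

lemma exists_approx (hW : IsAdmissibleEnergy ι g xA W)
    (hw : ∀ p : V × V, W (xA + ι p.1) (xA + ι p.2) = ((w p : ℝ) : EReal)) :
    ∃ C δ : ℝ, 0 ≤ C ∧ 0 < δ ∧ ∀ p q : V, riemDist ι g (xA + ι p) (xA + ι q) ≤ δ →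
      |w (p, q) - riemDist ι g (xA + ι p) (xA + ι q) ^ 2| ≤
        C * riemDist ι g (xA + ι p) (xA + ι q) ^ 3 := by
  obtain ⟨C, δ, hδ, h⟩ := hW.approx
  refine ⟨|C|, δ, abs_nonneg C, hδ, fun p q hd => ?_⟩
  have h1 := h (xA + ι p) ⟨_, rfl⟩ (xA + ι q) ⟨_, rfl⟩ hd
  rw [hw (p, q), EReal.coe_le_coe_iff, EReal.coe_le_coe_iff] at h1
  have h3 := pow_nonneg (riemDist_nonneg (ι := ι) (g := g) (xA + ι p) (xA + ι q)) 3
  have h4 := mul_le_mul_of_nonneg_right (le_abs_self C) h3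
  rw [abs_le]
  constructor <;> linarith [h1.1, h1.2]

lemma self_eq_zero [CompleteSpace V] (hW : IsAdmissibleEnergy ι g xA W)
    (hg : IsAdmissibleMetric g)
    (hw : ∀ p : V × V, W (xA + ι p.1) (xA + ι p.2) = ((w p : ℝ) : EReal)) (p : V) :
    w (p, p) = 0 := by
  obtain ⟨C, δ, -, hδ, h⟩ := hW.exists_approx hw
  simpa [hg.riemDist_self] using h p p (by rw [hg.riemDist_self]; exact hδ.le)

/-- Where `w` is small, it is bounded below by the metric frozen at the first point, up to a factor
arbitrarily close to one. -/
lemma exists_le [CompleteSpace V] (hW : IsAdmissibleEnergy ι g xA W) (hg : IsAdmissibleMetric g)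
    (hgc : Continuous g) (hι : Function.Injective ι)
    (hw : ∀ p : V × V, W (xA + ι p.1) (xA + ι p.2) = ((w p : ℝ) : EReal)) {η : ℝ} (hη : 0 < η) :
    ∃ ω > 0, ∀ p q, w (p, q) < ω → (1 - η) * g (xA + ι p) (q - p) (q - p) ≤ w (p, q) := by
  obtain ⟨C, δ, hC, hδ, happ⟩ := hW.exists_approx hw
  obtain ⟨γ, hγm, -, hγ0, hγ⟩ := hW.coercive
  -- two factors `1 - θ` are lost, and `(1 - θ)² ≥ 1 - η`
  set θ := min η 1 / 2 with hθ
  have hθ0 : 0 < θ := by positivity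
  have hθ1 : θ ≤ 1 / 2 := by rw [hθ]; linarith [min_le_right η 1]
  have hθη : 2 * θ ≤ η := by rw [hθ]; linarith [min_le_left η 1]
  obtain ⟨ρ, hρ, hdist⟩ := hg.exists_le_riemDist_sq hgc hι hθ0 (by linarith)
  set r := min (min ρ δ) (θ / (C + 1)) with hr
  have hr0 : 0 < r := by positivity
  refine ⟨γ r, by rw [← hγ0]; exact hγm self_mem_Ici hr0.le hr0, fun p q hpq => ?_⟩
  have h1 := hγ (xA + ι p) ⟨_, rfl⟩ (xA + ι q) ⟨_, rfl⟩
  rw [hw (p, q), EReal.coe_le_coe_iff] at h1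
  have hd0 := riemDist_nonneg (ι := ι) (g := g) (xA + ι p) (xA + ι q)
  have happ := happ p q
  have hdist := hdist (xA + ι p) (q - p)
  rw [map_sub, add_assoc, add_sub_cancel] at hdist
  set d := riemDist ι g (xA + ι p) (xA + ι q)
  have hdr : d < r := (hγm.lt_iff_lt hd0 hr0.le).1 (h1.trans_lt hpq)
  have hdρ : d < ρ := hdr.trans_le ((min_le_left _ _).trans (min_le_left _ _))
  have hdδ : d ≤ δ := hdr.le.trans ((min_le_left _ _).trans (min_le_right _ _))
  have hdC : C * d ≤ θ := by
    have : d ≤ θ / (C + 1) := hdr.le.trans (min_le_right _ _)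
    rw [le_div_iff₀ (by positivity)] at this
    nlinarith
  have h2 := (abs_le.1 (happ hdδ)).1
  have h3 := hdist hdρ
  have h4 := hg.nonneg (xA + ι p) (q - p)
  have h5 : (1 - θ) * d ^ 2 ≤ w (p, q) := by nlinarith [sq_nonneg d]
  have h6 := mul_le_mul_of_nonneg_left h3 (by linarith : (0 : ℝ) ≤ 1 - θ)
  nlinarith [sq_nonneg θ]

end IsAdmissibleEnergy

/-- Sampling a path at the points `k / K` yields discrete paths whose energies are asymptotically
at most the energy of the path. -/
lemma IsPathBetween.eventually_discrete_le [CompleteSpace V] (hg : IsAdmissibleMetric g)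
    (hgc : Continuous g) (hι : Function.Injective ι) (hW : IsAdmissibleEnergy ι g xA W)
    (hw : ∀ p : V × V, W (xA + ι p.1) (xA + ι p.2) = ((w p : ℝ) : EReal)) {p q : V}
    {x : ℝ → Y} {v : ℝ → V} (h : IsPathBetween ι (xA + ι p) (xA + ι q) x v) {ε : ℝ} (hε : 0 < ε) :
    ∀ᶠ K : ℕ in atTop, ∃ u : ℕ → V, u 0 = p ∧ u K = q ∧
      K * ∑ k ∈ Finset.range K, w (u k, u (k + 1)) ≤ pathEnergy g x v + ε := by
  obtain ⟨C, δ, hC, hδ, happ⟩ := hW.exists_approx hw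
  obtain ⟨h, h0, h1⟩ := h
  set E := pathEnergy g x v with hE
  have hE0 : 0 ≤ E := hg.pathEnergy_nonneg x v
  have hlim : Tendsto (fun K : ℕ => √(E / K)) atTop (𝓝 0) := by
    have := (tendsto_const_div_atTop_nhds_zero_nat E).sqrt
    simpa using this
  have hlim2 : Tendsto (fun K : ℕ => E * (1 + C * √(E / K))) atTop (𝓝 E) := by
    simpa using ((hlim.const_mul C).const_add 1).const_mul E
  filter_upwards [hlim.eventually_le_const hδ, hlim2.eventually_le_const
    (by linarith : E < E + ε), eventually_gt_atTop 0] with K hKδ hKε hK0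
  have hK : (0 : ℝ) < K := by exact_mod_cast hK0
  have hmem : ∀ k ≤ K, (k / K : ℝ) ∈ Icc (0 : ℝ) 1 := fun k hk =>
    ⟨by positivity, (div_le_one hK).2 (by exact_mod_cast hk)⟩
  set u : ℕ → V := fun k => p + ∫ s in (0 : ℝ)..(k / K : ℝ), v s with hu
  have hxu : ∀ k ≤ K, x (k / K) = xA + ι (u k) := fun k hk => by
    rw [h.2 _ (hmem k hk), h0, hu, map_add, add_assoc]
  have huK : u K = q := by
    have := hxu K le_rfl
    rw [div_self hK.ne', h1] at this
    exact (hι (add_left_cancel this)).symm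
  refine ⟨u, by simp [hu], huK, ?_⟩
  set e : ℕ → ℝ := fun k => ∫ r in (k / K : ℝ)..((k + 1 : ℕ) / K : ℝ), g (x r) (v r) (v r) with he
  have hsum : ∑ k ∈ Finset.range K, e k = E := by
    rw [he, intervalIntegral.sum_integral_adjacent_intervals (a := fun k : ℕ => (k / K : ℝ))]
    · simp [hE, pathEnergy, div_self hK.ne']
    · intro k hk
      exact h.intervalIntegrable_energy hg hgc (hmem k hk.le) (hmem (k + 1) hk)
  have he0 : ∀ k, 0 ≤ e k := fun k =>
    intervalIntegral.integral_nonneg (by gcongr; simp) fun _ _ => hg.nonneg _ _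
  have hstep : ∀ k ∈ Finset.range K, w (u k, u (k + 1)) ≤ e k / K * (1 + C * √(E / K)) := by
    intro k hk
    have hkK : k < K := Finset.mem_range.1 hk
    have hlt : (k / K : ℝ) < ((k + 1 : ℕ) / K : ℝ) := by gcongr; simp
    have hd := (h.isPathBetween_restrict (hmem k hkK.le) (hmem (k + 1) hkK) hlt).riemDist_sq_le hg
    rw [IsSobolevPath.pathEnergy_restrict, hxu k hkK.le, hxu (k + 1) hkK] at hd
    have hdiff : ((k + 1 : ℕ) / K : ℝ) - (k / K : ℝ) = 1 / K := by
      push_cast; ring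
    have hd0 := riemDist_nonneg (ι := ι) (g := g) (xA + ι (u k)) (xA + ι (u (k + 1)))
    have happ := happ (u k) (u (k + 1))
    set d := riemDist ι g (xA + ι (u k)) (xA + ι (u (k + 1)))
    have hd' : d ^ 2 ≤ e k / K := by
      rw [hdiff] at hd
      exact hd.trans_eq (by rw [he]; ring)
    have hek : e k ≤ E := by
      rw [← hsum]
      exact Finset.single_le_sum (fun k _ => he0 k) hk
    have hdE : d ≤ √(E / K) := Real.le_sqrt_of_sq_le (hd'.trans (by gcongr))
    have h2 := (abs_le.1 (happ (hdE.trans hKδ))).2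
    have hek0 := he0 k
    calc w (u k, u (k + 1)) ≤ d ^ 2 * (1 + C * d) := by linarith [h2]
      _ ≤ e k / K * (1 + C * √(E / K)) := by gcongr
  calc K * ∑ k ∈ Finset.range K, w (u k, u (k + 1))
      ≤ K * ∑ k ∈ Finset.range K, e k / K * (1 + C * √(E / K)) := by
        gcongr with k hk
        exact hstep k hk
    _ = E * (1 + C * √(E / K)) := by
        rw [← Finset.sum_mul, ← Finset.sum_div, hsum]
        field_simp
    _ ≤ E + ε := hKε

end

/-! ### The discrete Euler–Lagrange equation -/

section

variable {V Y : Type*} [NormedAddCommGroup V] [NormedSpace ℝ V]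
  [NormedAddCommGroup Y] [NormedSpace ℝ Y]

/-- First order Taylor formula for the derivative, with a quadratic remainder that is uniform on
balls where the third derivative is bounded. -/
lemma norm_fderiv_sub_sub_le {E : Type*} [NormedAddCommGroup E] [NormedSpace ℝ E] {f : E → ℝ}
    (hf : ContDiff ℝ 3 f) {R M : ℝ} (hM0 : 0 ≤ M)
    (hM : ∀ z ∈ Metric.closedBall (0 : E) R, ‖iteratedFDeriv ℝ 3 f z‖ ≤ M) {z z' : E}
    (hz : z ∈ Metric.closedBall (0 : E) R) (hz' : z' ∈ Metric.closedBall (0 : E) R) :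
    ‖fderiv ℝ f z' - fderiv ℝ f z - fderiv ℝ (fderiv ℝ f) z (z' - z)‖ ≤ M * ‖z' - z‖ ^ 2 := by
  have hf1 : ContDiff ℝ 2 (fderiv ℝ f) := hf.fderiv_right (by norm_num)
  have hf2 : ContDiff ℝ 1 (fderiv ℝ (fderiv ℝ f)) := hf1.fderiv_right (by norm_num)
  have hcb : Convex ℝ (Metric.closedBall (0 : E) R) := convex_closedBall 0 R
  have h3 : ∀ y ∈ Metric.closedBall (0 : E) R,
      ‖fderiv ℝ (fderiv ℝ f) y - fderiv ℝ (fderiv ℝ f) z‖ ≤ M * ‖y - z‖ := fun y hy => by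
    refine hcb.norm_image_sub_le_of_norm_fderiv_le (𝕜 := ℝ)
      (fun x _ => (hf2.differentiable (by norm_num)) x) (fun x hx => ?_) hz hy
    refine le_trans (le_of_eq ?_) (hM x hx)
    rw [← norm_iteratedFDeriv_zero (𝕜 := ℝ), norm_iteratedFDeriv_fderiv,
      norm_iteratedFDeriv_fderiv, norm_iteratedFDeriv_fderiv]
  have hs : Convex ℝ (Metric.closedBall (0 : E) R ∩ Metric.closedBall z ‖z' - z‖) :=
    hcb.inter (convex_closedBall _ _)
  have := hs.norm_image_sub_le_of_norm_hasFDerivWithin_le' (𝕜 := ℝ) (f := fderiv ℝ f)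
    (f' := fderiv ℝ (fderiv ℝ f)) (φ := fderiv ℝ (fderiv ℝ f) z) (C := M * ‖z' - z‖)
    (x := z) (y := z')
    (fun x _ => ((hf1.differentiable (by norm_num)) x).hasFDerivAt.hasFDerivWithinAt)
    (fun x hx => (h3 x hx.1).trans (by gcongr; simpa [dist_eq_norm] using hx.2))
    ⟨hz, by simp⟩ ⟨hz', by simp [dist_eq_norm]⟩
  rwa [mul_assoc, ← sq] at this

/-- The properties of the energy `w` in the coordinates of `V` that the discrete Euler–Lagrange
equation rests on: `w` is of class `C⁴` with derivatives bounded on bounded sets, is nonnegative, and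
vanishes on the diagonal. -/
structure IsTwoPointEnergy (w : V × V → ℝ) : Prop where
  contDiff : ContDiff ℝ 4 w
  bdd : ∀ B : Set (V × V), Bornology.IsBounded B → ∀ k ∈ Finset.Icc 1 4,
      ∃ M : ℝ, ∀ p ∈ B, ‖iteratedFDeriv ℝ k w p‖ ≤ M
  nonneg : ∀ p, 0 ≤ w p
  self : ∀ p, w (p, p) = 0

/-- `w` dominates `c ‖q - p‖²` where it is below the threshold `ω`. -/
def LocallyCoercive (w : V × V → ℝ) (c ω : ℝ) : Prop :=
  ∀ p q, w (p, q) < ω → c * ‖q - p‖ ^ 2 ≤ w (p, q)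

/-- A discrete path `u 0, …, u K` of least energy among those with the same end points. -/
def IsDiscreteMin (w : V × V → ℝ) (K : ℕ) (u : ℕ → V) : Prop :=
  ∀ u' : ℕ → V, u' 0 = u 0 → u' K = u K →
    ∑ k ∈ Finset.range K, w (u k, u (k + 1)) ≤ ∑ k ∈ Finset.range K, w (u' k, u' (k + 1))

namespace IsTwoPointEnergy

variable {w : V × V → ℝ}

lemma exists_taylor (hw : IsTwoPointEnergy w) (R : ℝ) : ∃ M : ℝ, 0 ≤ M ∧
    ∀ z z' : V × V, ‖z‖ ≤ R → ‖z'‖ ≤ R →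
      ‖fderiv ℝ w z' - fderiv ℝ w z - fderiv ℝ (fderiv ℝ w) z (z' - z)‖ ≤ M * ‖z' - z‖ ^ 2 := by
  obtain ⟨M, hM⟩ := hw.bdd (Metric.closedBall 0 R) Metric.isBounded_closedBall 3 (by simp)
  refine ⟨max M 0, le_max_right _ _, fun z z' hz hz' => ?_⟩
  exact norm_fderiv_sub_sub_le (hw.contDiff.of_le (by norm_num)) (le_max_right _ _)
    (fun y hy => (hM y hy).trans (le_max_left _ _)) (by simpa using hz) (by simpa using hz')

lemma differentiable (hw : IsTwoPointEnergy w) : Differentiable ℝ w :=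
  hw.contDiff.differentiable (by norm_num)

lemma differentiable_fderiv (hw : IsTwoPointEnergy w) : Differentiable ℝ (fderiv ℝ w) :=
  (hw.contDiff.fderiv_right (m := 3) (by norm_num)).differentiable (by norm_num)

lemma fderiv_self (hw : IsTwoPointEnergy w) (p : V) : fderiv ℝ w (p, p) = 0 :=
  IsLocalMin.fderiv_eq_zero (Eventually.of_forall fun z => by rw [hw.self]; exact hw.nonneg z)

lemma fderiv_fderiv_diag (hw : IsTwoPointEnergy w) (p φ : V) :
    fderiv ℝ (fderiv ℝ w) (p, p) (φ, φ) = 0 := by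
  have h1 : HasFDerivAt (fun q : V => fderiv ℝ w (q, q))
      ((fderiv ℝ (fderiv ℝ w) (p, p)).comp
        ((ContinuousLinearMap.id ℝ V).prod (ContinuousLinearMap.id ℝ V))) p :=
    HasFDerivAt.comp p (hw.differentiable_fderiv (p, p)).hasFDerivAt
      ((hasFDerivAt_id p).prodMk (hasFDerivAt_id p))
  have h2 : (fun q : V => fderiv ℝ w (q, q)) = fun _ => 0 := funext hw.fderiv_self
  rw [h2] at h1
  have h3 := h1.unique (hasFDerivAt_const _ _)
  simpa using congrArg (fun A => A φ) h3

lemma fderiv_fderiv_symm (hw : IsTwoPointEnergy w) (z y y' : V × V) :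
    fderiv ℝ (fderiv ℝ w) z y y' = fderiv ℝ (fderiv ℝ w) z y' y :=
  (hw.contDiff.contDiffAt.isSymmSndFDerivAt (by simp; norm_num)) y y'

/-- The second derivative of `w` in its second argument is coercive on the diagonal, because `w`
itself grows quadratically there. -/
lemma le_fderiv_fderiv (hw : IsTwoPointEnergy w) {c ω : ℝ} (hc : 0 < c) (hω : 0 < ω)
    (hco : LocallyCoercive w c ω) (p h : V) :
    c * ‖h‖ ^ 2 ≤ fderiv ℝ (fderiv ℝ w) (p, p) (0, h) (0, h) := by
  set H := fderiv ℝ (fderiv ℝ w) (p, p) (0, h) (0, h) with hH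
  obtain ⟨M, hM0, hM⟩ := hw.exists_taylor (‖p‖ + ‖h‖)
  by_contra! hlt
  -- `φ t = w (p, p + t h)` is at least `c t² ‖h‖²`, while `φ' s ≤ s H + s² M ‖h‖³`
  have hd : ∀ t : ℝ, HasDerivAt (fun t : ℝ => w (p, p + t • h))
      (fderiv ℝ w (p, p + t • h) (0, h)) t := fun t => by
    have h1 : HasDerivAt (fun t : ℝ => (p, p + t • h)) ((0, h) : V × V) t := by
      simpa using (hasDerivAt_const t p).prodMk (((hasDerivAt_id t).smul_const h).const_add p)
    exact (hw.differentiable (p, p + t • h)).hasFDerivAt.comp_hasDerivAt t h1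
  have hder : ∀ s : ℝ, 0 ≤ s → s ≤ 1 →
      fderiv ℝ w (p, p + s • h) (0, h) ≤ s * H + s ^ 2 * (M * ‖h‖ ^ 3) := fun s h0 h1 => by
    have hsh : ‖s • h‖ ≤ ‖h‖ := by
      rw [norm_smul, Real.norm_of_nonneg h0]
      exact mul_le_of_le_one_left (norm_nonneg h) h1
    have h2 := hM (p, p) (p, p + s • h)
      (max_le (by simp) (by simp))
      (max_le (by simp) ((norm_add_le _ _).trans (by simpa using hsh)))
    have h3 : ((p, p + s • h) : V × V) - (p, p) = s • (0, h) := by simp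
    rw [h3, hw.fderiv_self, sub_zero, map_smul, norm_smul, mul_pow, Real.norm_of_nonneg h0] at h2
    have h4 : ‖((0, h) : V × V)‖ = ‖h‖ := by simp
    rw [h4] at h2
    have h5 := (Real.le_norm_self _).trans ((fderiv ℝ w (p, p + s • h) -
      s • fderiv ℝ (fderiv ℝ w) (p, p) (0, h)).le_of_opNorm_le h2 (0, h))
    rw [h4] at h5
    simp only [FunLike.coe_sub, FunLike.coe_smul, Pi.sub_apply, Pi.smul_apply, smul_eq_mul] at h5
    rw [← hH] at h5
    linarith
  have hcont : Tendsto (fun t : ℝ => w (p, p + t • h)) (𝓝[>] 0) (𝓝 0) := by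
    have := (hd 0).continuousAt.tendsto
    simp only [zero_smul, add_zero, hw.self] at this
    exact this.mono_left nhdsWithin_le_nhds
  have hsmall : Tendsto (fun t : ℝ => t * (M * ‖h‖ ^ 3)) (𝓝[>] 0) (𝓝 0) := by
    have : Tendsto (fun t : ℝ => t * (M * ‖h‖ ^ 3)) (𝓝 0) (𝓝 (0 * (M * ‖h‖ ^ 3))) :=
      (continuous_id.mul continuous_const).tendsto 0
    rw [zero_mul] at this
    exact this.mono_left nhdsWithin_le_nhds
  obtain ⟨t, ⟨⟨ht1, ht2⟩, ht3⟩, ht0⟩ := (((hcont.eventually_lt_const hω).and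
    (hsmall.eventually_lt_const (sub_pos.2 hlt))).and
    (mem_nhdsWithin_of_mem_nhds (Iic_mem_nhds one_pos))).and self_mem_nhdsWithin |>.exists
  have ht0 : 0 < t := ht0
  have ht3 : t ≤ 1 := ht3
  obtain ⟨s, hs, hslope⟩ := exists_hasDerivAt_eq_slope (fun t : ℝ => w (p, p + t • h)) _ ht0
    (fun t _ => (hd t).continuousAt.continuousWithinAt) (fun t _ => hd t)
  simp only [zero_smul, add_zero, hw.self, sub_zero] at hslope
  rw [eq_div_iff ht0.ne'] at hslope
  have h1 := hco p (p + t • h) ht1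
  rw [add_sub_cancel_left, norm_smul, Real.norm_of_nonneg ht0.le, ← hslope] at h1
  have h2 := hder s hs.1.le (hs.2.le.trans ht3)
  have h3 : c * ‖h‖ ^ 2 * t ≤ s * H + s ^ 2 * (M * ‖h‖ ^ 3) := by
    refine le_of_mul_le_mul_right ?_ ht0
    nlinarith [mul_le_mul_of_nonneg_right h2 ht0.le]
  have h4 : s ^ 2 * (M * ‖h‖ ^ 3) ≤ s * (t * (M * ‖h‖ ^ 3)) := by
    have : 0 ≤ M * ‖h‖ ^ 3 := by positivity
    nlinarith [mul_nonneg (mul_nonneg hs.1.le (sub_nonneg.2 hs.2.le)) this]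
  have h5 : s * (H + t * (M * ‖h‖ ^ 3)) < s * (c * ‖h‖ ^ 2) :=
    mul_lt_mul_of_pos_left (by linarith) hs.1
  have h6 : s * (c * ‖h‖ ^ 2) ≤ t * (c * ‖h‖ ^ 2) := by gcongr; exact hs.2.le
  linarith

/-- The discrete Euler–Lagrange equation at an interior point. -/
lemma euler_lagrange (hw : IsTwoPointEnergy w) {K : ℕ} {u : ℕ → V} (hu : IsDiscreteMin w K u)
    {k : ℕ} (hk : k + 1 < K) (φ : V) :
    fderiv ℝ w (u k, u (k + 1)) (0, φ) + fderiv ℝ w (u (k + 1), u (k + 2)) (φ, 0) = 0 := by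
  classical
  set f : V → ℝ := fun y => w (u k, y) + w (y, u (k + 2)) with hf
  have hmin : IsLocalMin f (u (k + 1)) := Eventually.of_forall fun y => by
    set u' := Function.update u (k + 1) y with hu'
    have h1 := hu u' (by simp [hu']) (by simp [hu', hk.ne'])
    rw [← sub_nonneg, ← Finset.sum_sub_distrib] at h1
    have h2 : ∑ j ∈ Finset.range K, (w (u' j, u' (j + 1)) - w (u j, u (j + 1))) =
        ∑ j ∈ {k, k + 1}, (w (u' j, u' (j + 1)) - w (u j, u (j + 1))) := by
      symm
      refine Finset.sum_subset ?_ fun j _ hj => ?_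
      · intro j hj
        simp only [Finset.mem_insert, Finset.mem_singleton] at hj
        simp only [Finset.mem_range]
        omega
      · simp only [Finset.mem_insert, Finset.mem_singleton, not_or] at hj
        rw [hu', Function.update_of_ne hj.2, Function.update_of_ne (by omega), sub_self]
    rw [h2, Finset.sum_pair (by omega)] at h1
    simp only [hu', Function.update_self, ne_eq, Nat.left_eq_add, one_ne_zero, not_false_eq_true,
      Function.update_of_ne, add_assoc, Nat.reduceAdd] at h1
    rw [Function.update_of_ne (by omega)] at h1
    simp only [hf]
    linarith
  have hd : HasFDerivAt f ((fderiv ℝ w (u k, u (k + 1))).comp (ContinuousLinearMap.inr ℝ V V) +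
      (fderiv ℝ w (u (k + 1), u (k + 2))).comp (ContinuousLinearMap.inl ℝ V V)) (u (k + 1)) :=
    (HasFDerivAt.comp (u (k + 1)) (hw.differentiable _).hasFDerivAt
      (hasFDerivAt_prodMk_right _ _)).add
      (HasFDerivAt.comp (u (k + 1)) (hw.differentiable _).hasFDerivAt
        (hasFDerivAt_prodMk_left _ _))
  have := congrArg (fun A => A φ) (hmin.hasFDerivAt_eq_zero hd)
  simpa using this

/-- Consecutive increments of a discrete geodesic differ by a quadratically small amount. -/
lemma exists_norm_increment_sub_le (hw : IsTwoPointEnergy w) {c ω : ℝ} (hc : 0 < c) (hω : 0 < ω)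
    (hco : LocallyCoercive w c ω) (R : ℝ) :
    ∃ M : ℝ, 0 ≤ M ∧ ∀ (K : ℕ) (u : ℕ → V), IsDiscreteMin w K u → (∀ k ≤ K, ‖u k‖ ≤ R) →
      ∀ k, k + 1 < K → ‖(u (k + 2) - u (k + 1)) - (u (k + 1) - u k)‖ ≤
        M * (‖u (k + 2) - u (k + 1)‖ ^ 2 + ‖u (k + 1) - u k‖ ^ 2) := by
  obtain ⟨M, hM0, hM⟩ := hw.exists_taylor R
  refine ⟨M / c, by positivity, fun K u hu hR k hk => ?_⟩
  set y := u (k + 1)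
  set h := u (k + 2) - y with hh
  set l := y - u k with hl
  have hy : ‖((y, y) : V × V)‖ ≤ R := max_le (hR _ hk.le) (hR _ hk.le)
  have t1 := hM (y, y) (u k, y) hy (max_le (hR _ (by omega)) (hR _ hk.le))
  have t2 := hM (y, y) (y, u (k + 2)) hy (max_le (hR _ hk.le) (hR _ (by omega)))
  have e1 : ((u k, y) : V × V) - (y, y) = (-l, 0) := by simp [hl]
  have e2 : ((y, u (k + 2)) : V × V) - (y, y) = (0, h) := by simp [hh]
  have n1 : ‖((-l, 0) : V × V)‖ = ‖l‖ := by simp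
  have n2 : ‖((0, h) : V × V)‖ = ‖h‖ := by simp
  rw [hw.fderiv_self, sub_zero, e1, n1] at t1
  rw [hw.fderiv_self, sub_zero, e2, n2] at t2
  -- test the Euler–Lagrange equation with the second difference itself
  set φ := h - l with hφ
  have n3 : ‖((0, φ) : V × V)‖ = ‖φ‖ := by simp
  have n4 : ‖((φ, 0) : V × V)‖ = ‖φ‖ := by simp
  have el := hw.euler_lagrange hu hk φ
  set D := fderiv ℝ (fderiv ℝ w) (y, y) with hD
  have b1 := (Real.le_norm_self _).trans
    ((fderiv ℝ w (u k, y) - D (-l, 0)).le_of_opNorm_le t1 (0, φ))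
  have b2 := (Real.le_norm_self _).trans
    ((fderiv ℝ w (y, u (k + 2)) - D (0, h)).le_of_opNorm_le t2 (φ, 0))
  simp only [FunLike.coe_sub, Pi.sub_apply, n3, n4] at b1 b2
  have s : ∀ χ : V, D (χ, 0) = - D (0, χ) := fun χ => by
    have := hw.fderiv_fderiv_diag y χ
    rw [← hD, show ((χ, χ) : V × V) = (χ, 0) + (0, χ) by simp, map_add] at this
    exact eq_neg_of_add_eq_zero_left this
  have s1 : D (-l, 0) (0, φ) = D (0, l) (0, φ) := by
    rw [s, show ((0, -l) : V × V) = -(0, l) by simp, map_neg, neg_neg]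
  have s2 : D (0, h) (φ, 0) = - D (0, h) (0, φ) := by
    rw [hw.fderiv_fderiv_symm, s]
    simp only [FunLike.coe_neg, Pi.neg_apply]
    rw [hw.fderiv_fderiv_symm]
  have s3 : D (0, φ) (0, φ) = D (0, h) (0, φ) - D (0, l) (0, φ) := by
    have : D (0, φ) = D (0, h) - D (0, l) := by rw [← map_sub]; simp [hφ]
    rw [this, FunLike.coe_sub, Pi.sub_apply]
  have co := hw.le_fderiv_fderiv hc hω hco y φ
  rw [← hD, s3] at co
  rw [s1] at b1
  rw [s2] at b2
  rcases eq_or_ne φ 0 with h0 | h0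
  · rw [h0, norm_zero]; positivity
  · have hpos : 0 < ‖φ‖ := norm_pos_iff.2 h0
    rw [div_mul_eq_mul_div, le_div_iff₀ hc]
    refine le_of_mul_le_mul_right ?_ hpos
    nlinarith

end IsTwoPointEnergy

end

/-! ### A priori bounds and existence of discrete geodesics -/

section

variable {V Y : Type*} [NormedAddCommGroup V] [NormedSpace ℝ V]
  [NormedAddCommGroup Y] [NormedSpace ℝ Y]

variable {w : V × V → ℝ}

/-- The discrete velocity `K (u (k + 1) - u k)` of a discrete path of order `K`, continued as a
constant beyond the last index `K - 1`. -/
def discreteVelocity (K : ℕ) (u : ℕ → V) (k : ℕ) : V :=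
  (K : ℝ) • (u (min k (K - 1) + 1) - u (min k (K - 1)))

lemma discreteVelocity_of_lt {K k : ℕ} (u : ℕ → V) (hk : k < K) :
    discreteVelocity K u k = (K : ℝ) • (u (k + 1) - u k) := by
  rw [discreteVelocity, min_eq_left (by omega)]

lemma inv_smul_discreteVelocity {K k : ℕ} (u : ℕ → V) (hk : k < K) :
    (K : ℝ)⁻¹ • discreteVelocity K u k = u (k + 1) - u k := by
  rw [discreteVelocity_of_lt u hk, inv_smul_smul₀]
  have : K ≠ 0 := by omega
  exact_mod_cast this

/-- A discrete path is recovered from its velocity by summation. -/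
lemma eq_add_sum_discreteVelocity {K k : ℕ} (u : ℕ → V) (hk : k ≤ K) :
    u k = u 0 + (K : ℝ)⁻¹ • ∑ i ∈ Finset.range k, discreteVelocity K u i := by
  rw [Finset.smul_sum, Finset.sum_congr rfl fun i hi => inv_smul_discreteVelocity u
    ((Finset.mem_range.1 hi).trans_le hk), Finset.sum_range_sub]
  simp

lemma norm_sub_le_sum_range {F : ℕ → V} {d : ℕ → ℝ} {n : ℕ}
    (h : ∀ k, k + 1 < n → ‖F (k + 1) - F k‖ ≤ d k) (hd : ∀ k, 0 ≤ d k) {i j : ℕ} (hi : i < n)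
    (hj : j < n) : ‖F j - F i‖ ≤ ∑ k ∈ Finset.range (n - 1), d k := by
  wlog hij : i ≤ j generalizing i j
  · rw [norm_sub_rev]
    exact this hj hi (le_of_not_ge hij)
  rw [← dist_eq_norm, dist_comm]
  refine (dist_le_Ico_sum_of_dist_le hij (d := d) fun {k} _ h2 => ?_).trans ?_
  · rw [dist_comm, dist_eq_norm]
    exact h k (by omega)
  · refine Finset.sum_le_sum_of_subset_of_nonneg (fun k hk => ?_) fun k _ _ => hd k
    simp only [Finset.mem_Ico, Finset.mem_range] at hk ⊢
    omega

lemma sum_norm_discreteVelocity_le {K : ℕ} {u : ℕ → V} {B : ℝ}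
    (hB : ∑ k ∈ Finset.range K, ‖discreteVelocity K u k‖ ^ 2 ≤ K * B) {k : ℕ} (hk : k ≤ K) :
    ∑ i ∈ Finset.range k, ‖discreteVelocity K u i‖ ≤ K * (1 + B) := by
  have h1 : ∑ i ∈ Finset.range k, ‖discreteVelocity K u i‖ ≤
      ∑ i ∈ Finset.range K, ‖discreteVelocity K u i‖ :=
    Finset.sum_le_sum_of_subset_of_nonneg (Finset.range_mono hk) fun _ _ _ => norm_nonneg _
  have h2 : ∑ i ∈ Finset.range K, ‖discreteVelocity K u i‖ ≤
      ∑ i ∈ Finset.range K, (1 + ‖discreteVelocity K u i‖ ^ 2) :=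
    Finset.sum_le_sum fun i _ => by nlinarith [sq_nonneg (‖discreteVelocity K u i‖ - 1)]
  rw [Finset.sum_add_distrib] at h2
  simp only [Finset.sum_const, Finset.card_range, nsmul_eq_mul, mul_one] at h2
  linarith

namespace LocallyCoercive

/-- The discrete energy bounds the squared velocities in the mean. -/
lemma sum_norm_discreteVelocity_sq_le {c ω : ℝ} (hc : 0 < c) (hco : LocallyCoercive w c ω)
    (hnn : ∀ p, 0 ≤ w p) {E : ℝ} {K : ℕ} (hK : 0 < K) (hKE : E / K < ω) {u : ℕ → V}
    (hE : K * ∑ k ∈ Finset.range K, w (u k, u (k + 1)) ≤ E) :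
    ∑ k ∈ Finset.range K, ‖discreteVelocity K u k‖ ^ 2 ≤ K * (E / c) := by
  have hK' : (0 : ℝ) < K := by exact_mod_cast hK
  have hsum : ∑ k ∈ Finset.range K, w (u k, u (k + 1)) ≤ E / K := by
    rw [le_div_iff₀ hK']; linarith
  have hk : ∀ k ∈ Finset.range K, c * ‖u (k + 1) - u k‖ ^ 2 ≤ w (u k, u (k + 1)) := fun k hk =>
    hco _ _ (((Finset.single_le_sum (f := fun k => w (u k, u (k + 1))) (fun j _ => hnn _) hk).trans
      hsum).trans_lt hKE)
  have h2 := (Finset.sum_le_sum hk).trans hsum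
  rw [← Finset.mul_sum] at h2
  have h3 : ∑ k ∈ Finset.range K, ‖discreteVelocity K u k‖ ^ 2 =
      K ^ 2 * ∑ k ∈ Finset.range K, ‖u (k + 1) - u k‖ ^ 2 := by
    rw [Finset.mul_sum]
    refine Finset.sum_congr rfl fun k hk => ?_
    rw [discreteVelocity_of_lt u (Finset.mem_range.1 hk), norm_smul, mul_pow]
    simp
  rw [h3]
  rw [le_div_iff₀ hK'] at h2
  rw [mul_div_assoc', le_div_iff₀ hc]
  nlinarith

/-- Discrete paths of bounded energy stay in a bounded set of `V`. -/
lemma norm_le {c ω : ℝ} (hc : 0 < c) (hco : LocallyCoercive w c ω)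
    (hnn : ∀ p, 0 ≤ w p) {E : ℝ} {K : ℕ} (hK : 0 < K) (hKE : E / K < ω) {u : ℕ → V}
    (hE : K * ∑ k ∈ Finset.range K, w (u k, u (k + 1)) ≤ E) {k : ℕ} (hk : k ≤ K) :
    ‖u k‖ ≤ ‖u 0‖ + (1 + E / c) := by
  have hK' : (0 : ℝ) < K := by exact_mod_cast hK
  have h := sum_norm_discreteVelocity_le (sum_norm_discreteVelocity_sq_le hc hco hnn hK hKE hE) hk
  rw [eq_add_sum_discreteVelocity u hk]
  refine (norm_add_le _ _).trans ?_
  gcongr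
  rw [norm_smul, norm_inv, Real.norm_of_nonneg hK'.le, inv_mul_le_iff₀ hK']
  exact (norm_sum_le _ _).trans h

end LocallyCoercive

/-- Discrete geodesics of bounded energy have bounded and Lipschitz continuous velocities, with
constants that do not depend on the order `K`. -/
lemma IsTwoPointEnergy.exists_velocity_bounds (hw : IsTwoPointEnergy w) {c ω : ℝ} (hc : 0 < c)
    (hω : 0 < ω) (hco : LocallyCoercive w c ω) {E : ℝ} (hE0 : 0 ≤ E) (p : V) :
    ∃ R L : ℝ, 0 ≤ L ∧ ∀ (K : ℕ) (u : ℕ → V), 0 < K → E / K < ω → u 0 = p →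
      IsDiscreteMin w K u → K * ∑ k ∈ Finset.range K, w (u k, u (k + 1)) ≤ E →
      (∀ k, ‖discreteVelocity K u k‖ ≤ R) ∧
      ∀ k, ‖discreteVelocity K u (k + 1) - discreteVelocity K u k‖ ≤ L / K := by
  obtain ⟨M, hM0, hM⟩ := hw.exists_norm_increment_sub_le hc hω hco (‖p‖ + (1 + E / c))
  set B := E / c with hB
  have hB0 : 0 ≤ B := by positivity
  set R := 1 + B + 2 * M * B with hR
  refine ⟨R, 2 * M * R ^ 2, by positivity, fun K u hK hKE hu0 hu hE => ?_⟩
  have hK' : (0 : ℝ) < K := by exact_mod_cast hK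
  set a := discreteVelocity K u with ha
  have hsq : ∑ k ∈ Finset.range K, ‖a k‖ ^ 2 ≤ K * B :=
    hco.sum_norm_discreteVelocity_sq_le hc hw.nonneg hK hKE hE
  have hdiff : ∀ k, k + 1 < K → ‖a (k + 1) - a k‖ ≤ M / K * (‖a (k + 1)‖ ^ 2 + ‖a k‖ ^ 2) := by
    intro k hk
    have h1 := hM K u hu (fun k hk => hu0 ▸ hco.norm_le hc hw.nonneg hK hKE hE hk) k hk
    rw [← inv_smul_discreteVelocity u hk, ← inv_smul_discreteVelocity u (by omega : k < K), ← ha,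
      ← smul_sub, norm_smul, norm_smul, norm_smul, norm_inv, Real.norm_of_nonneg hK'.le] at h1
    rw [inv_mul_le_iff₀ hK'] at h1
    refine h1.trans_eq ?_
    field_simp
  -- summing up, the velocity has bounded variation, and its mean is bounded
  have hvar : ∀ i < K, ∀ j < K, ‖a j - a i‖ ≤ 2 * M * B := by
    intro i hi j hj
    refine (norm_sub_le_sum_range hdiff (fun k => by positivity) hi hj).trans ?_
    rw [← Finset.mul_sum, Finset.sum_add_distrib]
    have s1 : ∑ k ∈ Finset.range (K - 1), ‖a (k + 1)‖ ^ 2 ≤ K * B := by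
      refine le_trans ?_ hsq
      obtain ⟨n, rfl⟩ : ∃ n, K = n + 1 := ⟨K - 1, by omega⟩
      rw [Finset.sum_range_succ', Nat.add_sub_cancel]
      exact le_add_of_nonneg_right (by positivity)
    have s2 : ∑ k ∈ Finset.range (K - 1), ‖a k‖ ^ 2 ≤ K * B :=
      (Finset.sum_le_sum_of_subset_of_nonneg (Finset.range_mono (by omega))
        fun _ _ _ => by positivity).trans hsq
    calc M / K * (∑ k ∈ Finset.range (K - 1), ‖a (k + 1)‖ ^ 2 +
          ∑ k ∈ Finset.range (K - 1), ‖a k‖ ^ 2) ≤ M / K * (K * B + K * B) := by gcongr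
      _ = 2 * M * B := by field_simp; ring
  have hbd : ∀ j < K, ‖a j‖ ≤ R := by
    intro j hj
    have h1 : ∑ i ∈ Finset.range K, ‖a j‖ ≤ ∑ i ∈ Finset.range K, (‖a i‖ + 2 * M * B) :=
      Finset.sum_le_sum fun i hi => by
        have := norm_le_insert' (a j) (a i)
        linarith [hvar i (Finset.mem_range.1 hi) j hj]
    rw [Finset.sum_add_distrib] at h1
    simp only [Finset.sum_const, Finset.card_range, nsmul_eq_mul] at h1
    have h2 := sum_norm_discreteVelocity_le hsq le_rfl
    refine le_of_mul_le_mul_left ?_ hK'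
    rw [hR]
    linarith
  have hext : ∀ k, a k = a (min k (K - 1)) := fun k => by
    simp [ha, discreteVelocity]
  refine ⟨fun k => hext k ▸ hbd _ (by omega), fun k => ?_⟩
  rcases lt_or_ge (k + 1) K with hk | hk
  · refine (hdiff k hk).trans ?_
    have h1 := hbd (k + 1) hk
    have h2 := hbd k (by omega)
    calc M / K * (‖a (k + 1)‖ ^ 2 + ‖a k‖ ^ 2) ≤ M / K * (R ^ 2 + R ^ 2) := by gcongr
      _ = 2 * M * R ^ 2 / K := by ring
  · rw [hext k, hext (k + 1), min_eq_right (by omega), min_eq_right (by omega), sub_self, norm_zero]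
    positivity

/-- Discrete geodesics exist as soon as the order is so large that some discrete path has energy at
most `E`, and all those paths stay in a bounded set: the direct method applies, since balls of `V`
are compact in `Y` and `W` is lower semicontinuous there. -/
lemma exists_isDiscreteMin (hV : IsReflexive V) {ι : V →L[ℝ] Y} (hι : IsCompactEmbedding ι)
    {xA : Y} {W : Y → Y → EReal} (hlsc : LowerSemicontinuous fun p : Y × Y => W p.1 p.2)
    (hwW : ∀ p : V × V, W (xA + ι p.1) (xA + ι p.2) = ((w p : ℝ) : EReal)) {K : ℕ} {R E : ℝ}
    {p q : V} (hR : ∀ u : ℕ → V, u 0 = p → u K = q →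
      K * ∑ k ∈ Finset.range K, w (u k, u (k + 1)) ≤ E → ∀ k ≤ K, ‖u k‖ ≤ R)
    (hex : ∃ u : ℕ → V, u 0 = p ∧ u K = q ∧ K * ∑ k ∈ Finset.range K, w (u k, u (k + 1)) ≤ E) :
    ∃ u : ℕ → V, u 0 = p ∧ u K = q ∧ K * ∑ k ∈ Finset.range K, w (u k, u (k + 1)) ≤ E ∧
      IsDiscreteMin w K u := by
  obtain ⟨u₀, hu₀p, hu₀q, hu₀⟩ := hex
  set S : Set (ℕ → Y) := {y | (∀ k, y k ∈ ι '' Metric.closedBall 0 R) ∧ y 0 = ι p ∧ y K = ι q}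
    with hS
  have hSc : IsCompact S := by
    have h1 : IsCompact (Set.pi univ fun _ : ℕ => ι '' Metric.closedBall 0 R) :=
      isCompact_univ_pi fun _ => hV.isCompact_image_closedBall hι.compact R
    have h2 : IsClosed {y : ℕ → Y | y 0 = ι p ∧ y K = ι q} :=
      (isClosed_eq (continuous_apply 0) continuous_const).inter
        (isClosed_eq (continuous_apply K) continuous_const)
    convert h1.inter_right h2 using 1
    ext y
    simp [hS]
  set f : Y × Y → ℝ := fun z => (W (xA + z.1) (xA + z.2)).toReal with hf
  have hfw : ∀ a b : V, f (ι a, ι b) = w (a, b) := fun a b => by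
    simp only [hf, hwW (a, b), EReal.toReal_coe]
  have hflsc : ∀ k : ℕ, LowerSemicontinuousOn (fun y : ℕ → Y => f (y k, y (k + 1))) S := by
    intro k y hy r hr
    obtain ⟨⟨a, -, ha⟩, ⟨b, -, hb⟩⟩ := And.intro (hy.1 k) (hy.1 (k + 1))
    have hc : Continuous fun y : ℕ → Y => (xA + y k, xA + y (k + 1)) := by fun_prop
    have h1 : (r : EReal) < W (xA + y k) (xA + y (k + 1)) := by
      simp only [← ha, ← hb, hfw] at hr
      rw [← ha, ← hb, hwW (a, b)]
      exact_mod_cast hr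
    have h2 := (hc.tendsto y).eventually (hlsc _ _ h1)
    filter_upwards [mem_nhdsWithin_of_mem_nhds h2, self_mem_nhdsWithin] with y' h3 hy'
    obtain ⟨⟨a', -, ha'⟩, ⟨b', -, hb'⟩⟩ := And.intro (hy'.1 k) (hy'.1 (k + 1))
    simp only [← ha', ← hb', hfw]
    simp only [← ha', ← hb', hwW (a', b')] at h3
    exact_mod_cast h3
  have hsum : LowerSemicontinuousOn
      (fun y : ℕ → Y => ∑ k ∈ Finset.range K, f (y k, y (k + 1))) S :=
    lowerSemicontinuousOn_sum fun k _ => hflsc k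
  -- a discrete path of low energy, cut off after `K`, belongs to `S`
  have hmem : ∀ u : ℕ → V, u 0 = p → u K = q → (K * ∑ k ∈ Finset.range K, w (u k, u (k + 1)) ≤ E) →
      (fun k => ι (u (min k K))) ∈ S := fun u h0 h1 h2 =>
    ⟨fun k => ⟨_, by simpa using hR u h0 h1 h2 _ (min_le_right _ _), rfl⟩, by simp [h0],
      by simp [h1]⟩
  have hval : ∀ u : ℕ → V, ∑ k ∈ Finset.range K, f (ι (u (min k K)), ι (u (min (k + 1) K))) =
      ∑ k ∈ Finset.range K, w (u k, u (k + 1)) := fun u =>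
    Finset.sum_congr rfl fun k hk => by
      have := Finset.mem_range.1 hk
      rw [hfw, min_eq_left (by omega), min_eq_left (by omega)]
  obtain ⟨y, hyS, hy⟩ := hsum.exists_isMinOn ⟨_, hmem u₀ hu₀p hu₀q hu₀⟩ hSc
  choose u hu using hyS.1
  have hyu : ∑ k ∈ Finset.range K, f (y k, y (k + 1)) =
      ∑ k ∈ Finset.range K, w (u k, u (k + 1)) :=
    Finset.sum_congr rfl fun k _ => by rw [← (hu k).2, ← (hu (k + 1)).2, hfw]
  have hu0 : u 0 = p := hι.injective (by rw [(hu 0).2, hyS.2.1])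
  have huK : u K = q := hι.injective (by rw [(hu K).2, hyS.2.2])
  have hmin : ∀ u' : ℕ → V, u' 0 = p → u' K = q →
      (K * ∑ k ∈ Finset.range K, w (u' k, u' (k + 1)) ≤ E) →
      ∑ k ∈ Finset.range K, w (u k, u (k + 1)) ≤ ∑ k ∈ Finset.range K, w (u' k, u' (k + 1)) :=
    fun u' h0 h1 h2 => by
      have := isMinOn_iff.1 hy _ (hmem u' h0 h1 h2)
      rwa [hyu, hval] at this
  have huE : K * ∑ k ∈ Finset.range K, w (u k, u (k + 1)) ≤ E :=
    (mul_le_mul_of_nonneg_left (hmin u₀ hu₀p hu₀q hu₀) (Nat.cast_nonneg K)).trans hu₀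
  refine ⟨u, hu0, huK, huE, fun u' h0 h1 => ?_⟩
  rcases le_total (K * ∑ k ∈ Finset.range K, w (u' k, u' (k + 1))) E with h | h
  · exact hmin u' (h0.trans hu0) (h1.trans huK) h
  · rcases Nat.eq_zero_or_pos K with rfl | hK
    · simp
    · have hK' : (0 : ℝ) < K := by exact_mod_cast hK
      exact le_of_mul_le_mul_left (huE.trans h) hK'

end

/-! ### Weak limits of discrete paths -/

section

variable {V Y : Type*} [NormedAddCommGroup V] [NormedSpace ℝ V]
  [NormedAddCommGroup Y] [NormedSpace ℝ Y]

/-- The discrete path of step size `1 / K` with starting point `p` and velocity `a`. -/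
noncomputable def discreteSum (p : V) (K : ℕ) (a : ℕ → V) (k : ℕ) : V :=
  p + (K : ℝ)⁻¹ • ∑ i ∈ Finset.range k, a i

lemma abs_floor_sub_floor_le {s t : ℝ} (hs : 0 ≤ s) (ht : 0 ≤ t) (K : ℕ) :
    |(⌊t * K⌋₊ : ℝ) - ⌊s * K⌋₊| ≤ |t - s| * K + 1 := by
  have h1 := Nat.floor_le (by positivity : 0 ≤ t * K)
  have h2 := Nat.lt_floor_add_one (t * K)
  have h3 := Nat.floor_le (by positivity : 0 ≤ s * K)
  have h4 := Nat.lt_floor_add_one (s * K)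
  have h5 : |t * K - s * K| = |t - s| * K := by
    rw [← sub_mul, abs_mul, Nat.abs_cast]
  have h6 := abs_le.1 h5.le
  rw [abs_le]
  constructor <;> linarith [h6.1, h6.2]

/-- Uniform bounds on a discrete velocity and on its difference quotients. -/
structure HasVelocityBounds (R L : ℝ) (K : ℕ) (a : ℕ → V) : Prop where
  pos : 0 < K
  norm_le : ∀ k, ‖a k‖ ≤ R
  norm_sub_le : ∀ k, ‖a (k + 1) - a k‖ ≤ L / K

namespace HasVelocityBounds

variable {R L : ℝ} {K : ℕ} {a : ℕ → V} {s t : ℝ}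

lemma norm_sub_le_mul_abs (h : HasVelocityBounds R L K a) (i j : ℕ) :
    ‖a j - a i‖ ≤ L / K * |(j : ℝ) - i| := by
  wlog hij : i ≤ j generalizing i j
  · rw [norm_sub_rev, abs_sub_comm]
    exact this j i (le_of_not_ge hij)
  rw [← dist_eq_norm, dist_comm]
  refine (dist_le_Ico_sum_of_dist_le hij (d := fun _ => L / K) fun {k} _ _ => ?_).trans ?_
  · rw [dist_comm, dist_eq_norm]
    exact h.norm_sub_le k
  · rw [abs_of_nonneg (by simpa using hij)]
    simp only [Finset.sum_const, Nat.card_Ico, nsmul_eq_mul, Nat.cast_sub hij]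
    exact (mul_comm _ _).le

lemma nonneg_left (h : HasVelocityBounds R L K a) : 0 ≤ R := (norm_nonneg _).trans (h.norm_le 0)

lemma nonneg_right (h : HasVelocityBounds R L K a) : 0 ≤ L := by
  have h1 := (norm_nonneg _).trans (h.norm_sub_le 0)
  have h2 : (0 : ℝ) < K := by exact_mod_cast h.pos
  simpa [h2.ne'] using mul_nonneg h1 h2.le

lemma velocity_sub_le (h : HasVelocityBounds R L K a) (hs : 0 ≤ s) (ht : 0 ≤ t) :
    ‖a ⌊t * K⌋₊ - a ⌊s * K⌋₊‖ ≤ L * (|t - s| + 1 / K) := by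
  have hK : (0 : ℝ) < K := by exact_mod_cast h.pos
  have hL := h.nonneg_right
  calc ‖a ⌊t * K⌋₊ - a ⌊s * K⌋₊‖ ≤ L / K * |(⌊t * K⌋₊ : ℝ) - ⌊s * K⌋₊| :=
        h.norm_sub_le_mul_abs _ _
    _ ≤ L / K * (|t - s| * K + 1) := by gcongr; exact abs_floor_sub_floor_le hs ht K
    _ = L * (|t - s| + 1 / K) := by field_simp

/-- The discrete path is, up to the discretization error, differentiable from the right with
derivative `a`, with a quadratic remainder. -/
lemma discreteSum_sub_sub_le (h : HasVelocityBounds R L K a) (p : V) (hs : 0 ≤ s) (hst : s ≤ t) :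
    ‖discreteSum p K a ⌊t * K⌋₊ - discreteSum p K a ⌊s * K⌋₊ - (t - s) • a ⌊s * K⌋₊‖ ≤
      L * (t - s + 1 / K) ^ 2 + R * (1 / K) := by
  have hK : (0 : ℝ) < K := by exact_mod_cast h.pos
  have hL := h.nonneg_right
  have hR := h.nonneg_left
  have hij : ⌊s * K⌋₊ ≤ ⌊t * K⌋₊ := by gcongr
  have hf := abs_le.1 (abs_floor_sub_floor_le hs (hs.trans hst) K)
  rw [abs_of_nonneg (sub_nonneg.2 hst)] at hf
  have h1 := Nat.floor_le (by have := hs.trans hst; positivity : 0 ≤ t * K)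
  have h2 := Nat.lt_floor_add_one (t * K)
  have h3 := Nat.floor_le (by positivity : 0 ≤ s * K)
  have h4 := Nat.lt_floor_add_one (s * K)
  set i := ⌊s * K⌋₊
  set j := ⌊t * K⌋₊
  have hij' : (0 : ℝ) ≤ (j : ℝ) - i := by simpa using hij
  have e1 : discreteSum p K a j - discreteSum p K a i - (t - s) • a i =
      (K : ℝ)⁻¹ • ∑ k ∈ Finset.Ico i j, (a k - a i) +
        (((j : ℝ) - i) / K - (t - s)) • a i := by
    rw [Finset.sum_sub_distrib, Finset.sum_const, Nat.card_Ico, Finset.sum_Ico_eq_sub _ hij,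
      ← Nat.cast_smul_eq_nsmul ℝ, Nat.cast_sub hij, smul_sub, smul_sub, smul_smul,
      sub_smul _ (t - s), div_eq_inv_mul]
    simp only [discreteSum]
    abel
  have e2 : ‖∑ k ∈ Finset.Ico i j, (a k - a i)‖ ≤ ((j : ℝ) - i) * (L / K * ((j : ℝ) - i)) := by
    refine (norm_sum_le_of_le _ (f := fun k => a k - a i) (n := fun _ => L / K * ((j : ℝ) - i))
      fun k hk => ?_).trans ?_
    · have hk := Finset.mem_Ico.1 hk
      refine (h.norm_sub_le_mul_abs i k).trans ?_
      rw [abs_of_nonneg (by simpa using hk.1)]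
      gcongr
      exact hk.2.le
    · simp [Nat.cast_sub hij]
  have e3 : |((j : ℝ) - i) / K - (t - s)| ≤ 1 / K := by
    rw [div_sub' hK.ne', abs_div, abs_of_pos hK]
    gcongr
    rw [abs_le]
    constructor <;> linarith
  rw [e1]
  refine (norm_add_le _ _).trans (add_le_add ?_ ?_)
  · rw [norm_smul, norm_inv, Real.norm_of_nonneg hK.le]
    calc (K : ℝ)⁻¹ * ‖∑ k ∈ Finset.Ico i j, (a k - a i)‖
        ≤ (K : ℝ)⁻¹ * (((j : ℝ) - i) * (L / K * ((j : ℝ) - i))) := by gcongr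
      _ = L * (((j : ℝ) - i) / K) ^ 2 := by field_simp
      _ ≤ L * (t - s + 1 / K) ^ 2 := by
        gcongr
        rw [div_le_iff₀ hK, add_mul, one_div_mul_cancel hK.ne']
        exact hf.2
  · rw [norm_smul, Real.norm_eq_abs, mul_comm]
    gcongr
    exact h.norm_le i

lemma discreteSum_sub_le (h : HasVelocityBounds R L K a) (p : V) (hs : 0 ≤ s) (ht : 0 ≤ t) :
    ‖discreteSum p K a ⌊t * K⌋₊ - discreteSum p K a ⌊s * K⌋₊‖ ≤ R * (|t - s| + 1 / K) := by
  have hK : (0 : ℝ) < K := by exact_mod_cast h.pos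
  have hR := h.nonneg_left
  wlog hst : s ≤ t generalizing s t
  · rw [norm_sub_rev, abs_sub_comm]
    exact this ht hs (le_of_not_ge hst)
  have hij : ⌊s * K⌋₊ ≤ ⌊t * K⌋₊ := by gcongr
  have hf := (abs_le.1 (abs_floor_sub_floor_le hs ht K)).2
  have e1 : discreteSum p K a ⌊t * K⌋₊ - discreteSum p K a ⌊s * K⌋₊ =
      (K : ℝ)⁻¹ • ∑ k ∈ Finset.Ico ⌊s * K⌋₊ ⌊t * K⌋₊, a k := by
    rw [Finset.sum_Ico_eq_sub _ hij, smul_sub]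
    simp only [discreteSum]
    abel
  rw [e1, norm_smul, norm_inv, Real.norm_of_nonneg hK.le, inv_mul_le_iff₀ hK]
  refine (norm_sum_le_of_le _ (n := fun _ => R) fun k _ => h.norm_le k).trans ?_
  simp only [Finset.sum_const, Nat.card_Ico, nsmul_eq_mul, Nat.cast_sub hij]
  calc ((⌊t * K⌋₊ : ℝ) - ⌊s * K⌋₊) * R ≤ (|t - s| * K + 1) * R := by gcongr
    _ = K * (R * (|t - s| + 1 / K)) := by field_simp

lemma norm_discreteSum_le (h : HasVelocityBounds R L K a) (p : V) (ht : 0 ≤ t) :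
    ‖discreteSum p K a ⌊t * K⌋₊‖ ≤ ‖p‖ + R * (t + 1) := by
  have h1 := h.discreteSum_sub_le p le_rfl ht
  have h2 : discreteSum p K a ⌊(0 : ℝ) * K⌋₊ = p := by simp [discreteSum]
  rw [h2, sub_zero, abs_of_nonneg ht] at h1
  have h3 : (1 / K : ℝ) ≤ 1 := by
    rw [one_div]
    exact Nat.cast_inv_le_one K
  have hR := h.nonneg_left
  have h4 : R * (t + 1 / K) ≤ R * (t + 1) := by gcongr
  have h5 := norm_le_insert' (discreteSum p K a ⌊t * K⌋₊) p
  linarith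

end HasVelocityBounds

variable {U : Ultrafilter ℕ} {R L : ℝ} {a : ℕ → ℕ → V}

lemma tendsto_one_div_of_le_atTop (hU : (U : Filter ℕ) ≤ atTop) :
    Tendsto (fun K : ℕ => (1 / K : ℝ)) U (𝓝 0) :=
  tendsto_one_div_atTop_nhds_zero_nat.mono_left hU

/-- Along an ultrafilter, discrete paths with uniformly bounded and uniformly Lipschitz velocities
converge weakly, together with their velocities, to a continuously differentiable path. -/
lemma exists_limit_path [CompleteSpace V] (hV : IsReflexive V) (hU : (U : Filter ℕ) ≤ atTop)
    (ha : ∀ᶠ K in U, HasVelocityBounds R L K (a K)) (p : V) :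
    ∃ v : ℝ → V, Continuous v ∧
      (∀ t : ℝ, 0 ≤ t → WeakTendsto (fun K : ℕ => a K ⌊t * K⌋₊) U (v t)) ∧
      ∀ t : ℝ, 0 ≤ t → WeakTendsto (fun K : ℕ => discreteSum p K (a K) ⌊t * K⌋₊) U
        (p + ∫ s in (0 : ℝ)..t, v s) := by
  have h0 := tendsto_one_div_of_le_atTop hU
  have hv : ∀ t : ℝ, ∃ v, 0 ≤ t → WeakTendsto (fun K : ℕ => a K ⌊t * K⌋₊) U v := fun t => by
    obtain ⟨v, hv⟩ := hV.exists_weakTendsto U (ha.mono fun K h => h.norm_le ⌊t * K⌋₊)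
    exact ⟨v, fun _ => hv⟩
  have hX : ∀ t : ℝ, ∃ X, 0 ≤ t →
      WeakTendsto (fun K : ℕ => discreteSum p K (a K) ⌊t * K⌋₊) U X := fun t => by
    by_cases ht : 0 ≤ t
    · obtain ⟨X, hX⟩ := hV.exists_weakTendsto U (ha.mono fun K h => h.norm_discreteSum_le p ht)
      exact ⟨X, fun _ => hX⟩
    · exact ⟨0, fun h => absurd h ht⟩
  choose v₀ hv₀ using hv
  choose X hX using hX
  have hvL : ∀ s t, 0 ≤ s → 0 ≤ t → ‖v₀ t - v₀ s‖ ≤ L * |t - s| := fun s t hs ht => by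
    refine ((hv₀ t ht).sub (hv₀ s hs)).norm_le (b := fun K : ℕ => L * (|t - s| + 1 / K)) ?_
      (ha.mono fun K h => h.velocity_sub_le hs ht)
    simpa using (h0.const_add |t - s|).const_mul L
  have hXR : ∀ s t, 0 ≤ s → 0 ≤ t → ‖X t - X s‖ ≤ R * |t - s| := fun s t hs ht => by
    refine ((hX t ht).sub (hX s hs)).norm_le (b := fun K : ℕ => R * (|t - s| + 1 / K)) ?_
      (ha.mono fun K h => h.discreteSum_sub_le p hs ht)
    simpa using (h0.const_add |t - s|).const_mul R
  have hXv : ∀ s t, 0 ≤ s → s ≤ t → ‖X t - X s - (t - s) • v₀ s‖ ≤ L * (t - s) ^ 2 :=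
    fun s t hs hst => by
      refine (((hX t (hs.trans hst)).sub (hX s hs)).sub ((hv₀ s hs).const_smul (t - s))).norm_le
        (b := fun K : ℕ => L * (t - s + 1 / K) ^ 2 + R * (1 / K)) ?_
        (ha.mono fun K h => h.discreteSum_sub_sub_le p hs hst)
      simpa using ((((h0.const_add (t - s)).pow 2).const_mul L).add (h0.const_mul R))
  set v : ℝ → V := fun t => v₀ (max t 0) with hv
  have hvc : Continuous v := by
    refine continuous_iff_continuousAt.2 fun s => ?_
    have h1 : Tendsto (fun t : ℝ => L * |max t 0 - max s 0|) (𝓝 s) (𝓝 0) := by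
      have : Continuous fun t : ℝ => L * |max t 0 - max s 0| := by fun_prop
      simpa using this.tendsto s
    exact tendsto_iff_norm_sub_tendsto_zero.2 (squeeze_zero (fun _ => norm_nonneg _)
      (fun t => hvL _ _ (le_max_right _ _) (le_max_right _ _)) h1)
  have hvv : ∀ t, 0 ≤ t → v t = v₀ t := fun t ht => by simp [hv, ht]
  have hX0 : X 0 = p := by
    refine (hX 0 le_rfl).unique fun φ => ?_
    simp [discreteSum]
  refine ⟨v, hvc, fun t ht => hvv t ht ▸ hv₀ t ht, fun t ht => ?_⟩
  have hint : ∫ s in (0 : ℝ)..t, v s = X t - X 0 := by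
    refine intervalIntegral.integral_eq_sub_of_hasDeriv_right ?_ (fun s hs => ?_)
      (hvc.intervalIntegrable _ _)
    · rw [uIcc_of_le ht]
      intro s hs
      have h1 : Tendsto (fun r : ℝ => R * |r - s|) (𝓝[Icc 0 t] s) (𝓝 0) := by
        have : Continuous fun r : ℝ => R * |r - s| := by fun_prop
        have h2 := this.tendsto s
        rw [sub_self, abs_zero, mul_zero] at h2
        exact h2.mono_left nhdsWithin_le_nhds
      refine tendsto_iff_norm_sub_tendsto_zero.2 (squeeze_zero' (Eventually.of_forall
        fun _ => norm_nonneg _) ?_ h1)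
      filter_upwards [self_mem_nhdsWithin] with r hr
      exact hXR s r hs.1 hr.1
    · rw [min_eq_left ht] at hs
      rw [hvv s hs.1.le, hasDerivWithinAt_iff_isLittleO]
      refine Asymptotics.IsBigO.trans_isLittleO (g := fun r : ℝ => (r - s) ^ 2) ?_ ?_
      · refine Asymptotics.IsBigO.of_bound L ?_
        filter_upwards [self_mem_nhdsWithin] with r hr
        rw [norm_pow, Real.norm_eq_abs, sq_abs]
        exact hXv s r hs.1.le (le_of_lt hr)
      · have : (fun r : ℝ => (r - s) ^ 2) =o[𝓝 s] fun r => r - s := by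
          have h2 : Tendsto (fun r : ℝ => r - s) (𝓝 s) (𝓝 0) := by
            simpa using (continuous_id.sub continuous_const).tendsto (f := fun r : ℝ => r - s) s
          have h3 := (Asymptotics.isLittleO_pow_id (𝕜 := ℝ) (n := 2) (by norm_num)).comp_tendsto h2
          simpa [Function.comp_def] using h3
        exact this.mono nhdsWithin_le_nhds
  rw [hint, hX0, add_sub_cancel]
  exact hX t ht

/-- The left endpoint Riemann sums of a continuous function converge. -/
lemma eventually_integral_le_sum {F : ℝ → ℝ} (hF : Continuous F) {ε : ℝ} (hε : 0 < ε) :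
    ∀ᶠ K : ℕ in atTop, ∫ t in (0 : ℝ)..1, F t ≤
      (K : ℝ)⁻¹ * ∑ k ∈ Finset.range K, F (k / K) + ε := by
  have huc := (isCompact_Icc (a := (0 : ℝ)) (b := 1)).uniformContinuousOn_of_continuous
    hF.continuousOn
  obtain ⟨δ, hδ, hd⟩ := Metric.uniformContinuousOn_iff.1 huc ε hε
  filter_upwards [tendsto_one_div_atTop_nhds_zero_nat.eventually_lt_const hδ,
    eventually_gt_atTop 0] with K hKδ hK0
  have hK : (0 : ℝ) < K := by exact_mod_cast hK0
  have hsum := intervalIntegral.sum_integral_adjacent_intervals (f := F) (μ := volume)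
    (a := fun k : ℕ => (k / K : ℝ)) (n := K) fun k _ => hF.intervalIntegrable _ _
  simp only [Nat.cast_zero, zero_div, div_self hK.ne'] at hsum
  rw [← hsum]
  have hstep : ∀ k ∈ Finset.range K, ∫ t in (k / K : ℝ)..((k + 1 : ℕ) / K : ℝ), F t ≤
      (K : ℝ)⁻¹ * (F (k / K) + ε) := by
    intro k hk
    have hkK : (k : ℝ) + 1 ≤ K := by exact_mod_cast Finset.mem_range.1 hk
    have hlen : ((k + 1 : ℕ) / K : ℝ) - k / K = (K : ℝ)⁻¹ := by push_cast; ring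
    have hle : (k / K : ℝ) ≤ ((k + 1 : ℕ) / K : ℝ) := by
      rw [← sub_nonneg, hlen]; positivity
    have h1 : ((k + 1 : ℕ) / K : ℝ) ≤ 1 := by
      rw [div_le_one hK]; push_cast; exact hkK
    have h2 : (0 : ℝ) ≤ k / K := by positivity
    have := intervalIntegral.integral_mono_on hle (hF.intervalIntegrable _ _)
      (intervalIntegrable_const (μ := volume) (c := F (k / K) + ε)) fun t ht => by
        have h3 := hd t ⟨h2.trans ht.1, ht.2.trans h1⟩ (k / K) ⟨h2, hle.trans h1⟩ (by
          rw [Real.dist_eq, abs_of_nonneg (sub_nonneg.2 ht.1)]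
          rw [one_div] at hKδ
          linarith [ht.2])
        rw [Real.dist_eq] at h3
        linarith [(abs_lt.1 h3).2]
    rwa [intervalIntegral.integral_const, hlen, smul_eq_mul] at this
  refine (Finset.sum_le_sum hstep).trans_eq ?_
  rw [← Finset.mul_sum, Finset.sum_add_distrib]
  simp only [Finset.sum_const, Finset.card_range, nsmul_eq_mul]
  field_simp

/-- Weak lower semicontinuity of `(y, u) ↦ g_y(u, u)`, for norm convergence in `y`. -/
lemma IsAdmissibleMetric.eventually_sub_le {α : Type*} {l : Filter α}
    {g : Y → V →L[ℝ] V →L[ℝ] ℝ} (hg : IsAdmissibleMetric g) (hgc : Continuous g) {y : α → Y}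
    {y₀ : Y} {f : α → V} {u : V} (hy : Tendsto y l (𝓝 y₀)) (hf : WeakTendsto f l u)
    (hb : ∀ᶠ i in l, ‖f i‖ ≤ R) {ε : ℝ} (hε : 0 < ε) :
    ∀ᶠ i in l, g y₀ u u - ε < g (y i) (f i) (f i) := by
  have h1 : Tendsto (fun i => g (y i)) l (𝓝 (g y₀)) := (hgc.tendsto y₀).comp hy
  have h2 : Tendsto (fun i => g (y i) u) l (𝓝 (g y₀ u)) :=
    ((ContinuousLinearMap.apply ℝ (V →L[ℝ] ℝ) u).continuous.tendsto (g y₀)).comp h1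
  have h3 : Tendsto (fun i => g (y i) u u) l (𝓝 (g y₀ u u)) :=
    ((ContinuousLinearMap.apply ℝ ℝ u).continuous.tendsto (g y₀ u)).comp h2
  have h4 : Tendsto (fun i => g (y i) u (f i) - g y₀ u (f i)) l (𝓝 0) := by
    refine squeeze_zero_norm' (a := fun i => ‖g (y i) u - g y₀ u‖ * R) ?_ ?_
    · filter_upwards [hb] with i hi
      exact ((g (y i) u - g y₀ u).le_opNorm (f i)).trans (by gcongr)
    · simpa using (tendsto_iff_norm_sub_tendsto_zero.1 h2).mul_const R
  have h5 : Tendsto (fun i => g (y i) u (f i)) l (𝓝 (g y₀ u u)) := by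
    simpa using h4.add (hf (g y₀ u))
  have h6 : Tendsto (fun i => 2 * g (y i) u (f i) - g (y i) u u) l (𝓝 (g y₀ u u)) := by
    have := (h5.const_mul 2).sub h3
    rwa [two_mul, add_sub_cancel_right] at this
  filter_upwards [h6.eventually_const_lt (sub_lt_self _ hε)] with i hi
  refine hi.trans_le ?_
  have := hg.nonneg (y i) (f i - u)
  simp only [map_sub, FunLike.coe_sub, Pi.sub_apply] at this
  rw [hg.symm (y i) (f i) u] at this
  linarith

/-- The weak lower semicontinuity of the metric, uniformly in time: along the weak convergence of
equicontinuous discrete paths, the discrete energy densities are eventually bounded below by the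
energy density of the limit path. -/
lemma eventually_density_le [CompleteSpace V] {ι : V →L[ℝ] Y} (hι : IsCompactOperator ι)
    {g : Y → V →L[ℝ] V →L[ℝ] ℝ} (hg : IsAdmissibleMetric g) (hgc : Continuous g) (xA : Y)
    (hU : (U : Filter ℕ) ≤ atTop) (ha : ∀ᶠ K in U, HasVelocityBounds R L K (a K)) {p : V}
    {v : ℝ → V} (hvc : Continuous v)
    (hv : ∀ t : ℝ, 0 ≤ t → WeakTendsto (fun K : ℕ => a K ⌊t * K⌋₊) U (v t))
    (hX : ∀ t : ℝ, 0 ≤ t → WeakTendsto (fun K : ℕ => discreteSum p K (a K) ⌊t * K⌋₊) U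
        (p + ∫ s in (0 : ℝ)..t, v s)) {ε : ℝ} (hε : 0 < ε) :
    ∀ᶠ K : ℕ in U, ∀ k < K, g (xA + ι (p + ∫ s in (0 : ℝ)..(k / K : ℝ), v s)) (v (k / K)) (v (k / K))
      - ε ≤ g (xA + ι (discreteSum p K (a K) k)) (a K k) (a K k) := by
  have h0 := tendsto_one_div_of_le_atTop hU
  set x : ℝ → Y := fun t => xA + ι (p + ∫ s in (0 : ℝ)..t, v s) with hx
  have hxc : Continuous x := by
    have := intervalIntegral.continuous_primitive (μ := volume) (fun s t => hvc.intervalIntegrable s t) 0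
    exact continuous_const.add (ι.continuous.comp (continuous_const.add this))
  set F : ℝ → ℝ := fun t => g (x t) (v t) (v t) with hF
  have hFc : Continuous F := ((hgc.comp hxc).clm_apply hvc).clm_apply hvc
  have key : ∀ t ∈ Icc (0 : ℝ) 1, {z : ℕ × ℝ | 0 ≤ z.2 → F z.2 - ε ≤
      g (xA + ι (discreteSum p z.1 (a z.1) ⌊z.2 * z.1⌋₊)) (a z.1 ⌊z.2 * z.1⌋₊)
        (a z.1 ⌊z.2 * z.1⌋₊)} ∈ (U : Filter ℕ) ×ˢ 𝓝 t := by
    intro t ht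
    set l : Filter (ℕ × ℝ) := ((U : Filter ℕ) ×ˢ 𝓝 t) ⊓ 𝓟 {z | 0 ≤ z.2} with hl
    have hl1 : Tendsto Prod.fst l U := tendsto_fst.mono_left inf_le_left
    have hl2 : Tendsto Prod.snd l (𝓝 t) := tendsto_snd.mono_left inf_le_left
    have hl3 : ∀ᶠ z in l, 0 ≤ z.2 := mem_inf_of_right (mem_principal_self _)
    have hal : ∀ᶠ z in l, HasVelocityBounds R L z.1 (a z.1) := hl1.eventually ha
    have hb : Tendsto (fun z : ℕ × ℝ => |z.2 - t| + 1 / z.1) l (𝓝 0) := by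
      have h1 : Tendsto (fun z : ℕ × ℝ => |z.2 - t|) l (𝓝 0) := by
        simpa using ((hl2.sub_const t).abs)
      simpa using h1.add (h0.comp hl1)
    have hv' : WeakTendsto (fun z : ℕ × ℝ => a z.1 ⌊z.2 * z.1⌋₊) l (v t) := by
      refine WeakTendsto.congr_of_norm_sub (f := fun z : ℕ × ℝ => a z.1 ⌊t * z.1⌋₊)
        (fun φ => (hv t ht.1 φ).comp hl1) (b := fun z => L * (|z.2 - t| + 1 / z.1))
        (by simpa using hb.const_mul L) ?_
      filter_upwards [hal, hl3] with z hz hz0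
      exact hz.velocity_sub_le ht.1 hz0
    have hXt : Tendsto (fun K : ℕ => ι (discreteSum p K (a K) ⌊t * K⌋₊)) U
        (𝓝 (ι (p + ∫ s in (0 : ℝ)..t, v s))) := by
      exact (hX t ht.1).tendsto_of_isCompactOperator hι
        (ha.mono fun K h => h.norm_discreteSum_le p ht.1)
    have hX' : Tendsto (fun z : ℕ × ℝ => xA + ι (discreteSum p z.1 (a z.1) ⌊z.2 * z.1⌋₊)) l
        (𝓝 (x t)) := by
      refine Tendsto.const_add xA ?_
      have h1 : Tendsto (fun z : ℕ × ℝ => ι (discreteSum p z.1 (a z.1) ⌊z.2 * z.1⌋₊) -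
          ι (discreteSum p z.1 (a z.1) ⌊t * z.1⌋₊)) l (𝓝 0) := by
        refine squeeze_zero_norm' (a := fun z => ‖ι‖ * (R * (|z.2 - t| + 1 / z.1))) ?_
          (by simpa using (hb.const_mul R).const_mul ‖ι‖)
        filter_upwards [hal, hl3] with z hz hz0
        rw [← map_sub]
        exact (ι.le_opNorm _).trans (by gcongr; exact hz.discreteSum_sub_le p ht.1 hz0)
      simpa using h1.add (hXt.comp hl1)
    have h1 := hg.eventually_sub_le hgc hX' hv' (hal.mono fun z hz => hz.norm_le _) (half_pos hε)
    have h2 : ∀ᶠ z in l, F z.2 < F t + ε / 2 :=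
      ((hFc.tendsto t).comp hl2).eventually_lt_const (by linarith)
    have h3 := h1.and h2
    rw [hl, eventually_inf_principal] at h3
    filter_upwards [h3] with z hz hz0
    have := hz hz0
    simp only [hF] at this ⊢
    linarith [this.1, this.2]
  have hU2 := isCompact_Icc.mem_prod_nhdsSet_of_forall key
  obtain ⟨A, hA, B, hB, hAB⟩ := mem_prod_iff.1 hU2
  filter_upwards [hA, ha] with K hKA hKa k hk
  have hK : (0 : ℝ) < K := by exact_mod_cast hKa.pos
  have hkK : (k / K : ℝ) ∈ Icc (0 : ℝ) 1 :=
    ⟨by positivity, (div_le_one hK).2 (by exact_mod_cast hk.le)⟩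
  have := hAB (mk_mem_prod hKA (subset_of_mem_nhdsSet hB hkK)) hkK.1
  simpa only [div_mul_cancel₀ _ hK.ne', Nat.floor_natCast] using this

end

/-! ### Limits of discrete geodesics are geodesics -/

section

variable {V Y : Type*} [NormedAddCommGroup V] [NormedSpace ℝ V]
  [NormedAddCommGroup Y] [NormedSpace ℝ Y]

variable {ι : V →L[ℝ] Y} {g : Y → V →L[ℝ] V →L[ℝ] ℝ} {xA : Y} {W : Y → Y → EReal}
  {w : V × V → ℝ}

/-- Weak limits of discrete geodesics along an ultrafilter are continuous geodesics, and the initial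
discrete velocities converge weakly to the initial velocity. -/
lemma exists_isGeodesic_of_ultrafilter [CompleteSpace V] (hV : IsReflexive V)
    (hι : IsCompactEmbedding ι) (hg : IsAdmissibleMetric g) (hgc : Continuous g)
    (hW : IsAdmissibleEnergy ι g xA W)
    (hw : ∀ p : V × V, W (xA + ι p.1) (xA + ι p.2) = ((w p : ℝ) : EReal))
    {U : Ultrafilter ℕ} (hU : (U : Filter ℕ) ≤ atTop) {p q : V} {u : ℕ → ℕ → V} {R L : ℝ}
    (hu : ∀ᶠ K in atTop, u K 0 = p ∧ u K K = q ∧ IsDiscreteMin w K (u K) ∧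
      HasVelocityBounds R L K (discreteVelocity K (u K))) :
    ∃ v : ℝ → V, Continuous v ∧
      IsGeodesic ι g (xA + ι p) (xA + ι q) (fun t => xA + ι (p + ∫ s in (0 : ℝ)..t, v s)) v ∧
      WeakTendsto (fun K => discreteVelocity K (u K) 0) U (v 0) := by
  set a : ℕ → ℕ → V := fun K => discreteVelocity K (u K) with ha
  have hb : ∀ᶠ K in U, HasVelocityBounds R L K (a K) := hU (hu.mono fun K h => h.2.2.2)
  obtain ⟨v, hvc, hv, hX⟩ := exists_limit_path hV hU hb p
  have hsum : ∀ᶠ K : ℕ in atTop, ∀ k ≤ K, discreteSum p K (a K) k = u K k :=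
    hu.mono fun K h k hk => by
      rw [eq_add_sum_discreteVelocity (u K) hk, h.1]
      rfl
  have hend : p + ∫ s in (0 : ℝ)..1, v s = q := by
    refine (hX 1 zero_le_one).unique fun φ => tendsto_const_nhds.congr' ?_
    filter_upwards [hU hsum, hU hu] with K h1 h2
    rw [one_mul, Nat.floor_natCast, h1 K le_rfl, h2.2.1]
  set x : ℝ → Y := fun t => xA + ι (p + ∫ s in (0 : ℝ)..t, v s) with hx
  have hxc : Continuous x := by
    have := intervalIntegral.continuous_primitive (μ := volume)
      (fun s t => hvc.intervalIntegrable s t) 0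
    exact continuous_const.add (ι.continuous.comp (continuous_const.add this))
  set F : ℝ → ℝ := fun t => g (x t) (v t) (v t) with hF
  have hFc : Continuous F := ((hgc.comp hxc).clm_apply hvc).clm_apply hvc
  refine ⟨v, hvc, ⟨⟨⟨?_, fun t _ => ?_⟩, by simp, by simp only [hend]⟩,
    fun y v' hy => ?_⟩, ?_⟩
  · exact (memLp_two_iff_integrable_sq_norm hvc.aestronglyMeasurable).2
      ((hvc.norm.pow 2).integrableOn_Icc)
  · simp only [intervalIntegral.integral_same, add_zero, map_add, add_assoc]
  · have key : ∀ ε : ℝ, 0 < ε → ε < 1 →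
        (1 - ε) * ((∫ t in (0 : ℝ)..1, F t) - 2 * ε) ≤ pathEnergy g y v' + ε := by
      intro ε hε hε1
      obtain ⟨ω, hω, hlow⟩ := hW.exists_le hg hgc hι.injective hw hε
      have hup := hy.eventually_discrete_le hg hgc hι.injective hW hw hε
      have hsmall : ∀ᶠ K : ℕ in atTop, (pathEnergy g y v' + ε) / K < ω :=
        (tendsto_const_div_atTop_nhds_zero_nat _).eventually_lt_const hω
      have hdens := eventually_density_le hι.compact hg hgc xA hU hb hvc hv hX hε
      obtain ⟨K, h1, h2, h3, h4, h5, h6⟩ := (hdens.and ((hup.filter_mono hU).and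
        ((hsmall.filter_mono hU).and ((hu.filter_mono hU).and ((hsum.filter_mono hU).and
          ((eventually_integral_le_sum hFc hε).filter_mono hU)))))).exists
      obtain ⟨u', hu'0, hu'K, hu'⟩ := h2
      have hK : (0 : ℝ) < K := by exact_mod_cast h4.2.2.2.pos
      have hE : K * ∑ k ∈ Finset.range K, w (u K k, u K (k + 1)) ≤ pathEnergy g y v' + ε :=
        (mul_le_mul_of_nonneg_left (h4.2.2.1 u' (hu'0.trans h4.1.symm) (hu'K.trans h4.2.1.symm))
          hK.le).trans hu'
      have hterm : ∀ k ∈ Finset.range K, (1 - ε) * ((K : ℝ)⁻¹ ^ 2 * (F (k / K) - ε)) ≤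
          w (u K k, u K (k + 1)) := by
        intro k hk
        have hkK := Finset.mem_range.1 hk
        have hwk : w (u K k, u K (k + 1)) < ω := by
          refine lt_of_le_of_lt ?_ h3
          rw [le_div_iff₀ hK, mul_comm]
          refine le_trans (mul_le_mul_of_nonneg_left ?_ hK.le) hE
          exact Finset.single_le_sum (f := fun k => w (u K k, u K (k + 1)))
            (fun j _ => hW.nonneg hw _) hk
        refine le_trans ?_ (hlow _ _ hwk)
        have h7 := h1 k hkK
        rw [h5 k hkK.le] at h7
        rw [← inv_smul_discreteVelocity (u K) hkK]
        simp only [map_smul, FunLike.coe_smul, Pi.smul_apply, smul_eq_mul]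
        rw [← mul_assoc (K : ℝ)⁻¹, ← sq]
        have : 0 < 1 - ε := by linarith
        gcongr
      have hsum2 := Finset.sum_le_sum hterm
      rw [← Finset.mul_sum, ← Finset.mul_sum, Finset.sum_sub_distrib] at hsum2
      simp only [Finset.sum_const, Finset.card_range, nsmul_eq_mul] at hsum2
      have hfin := (mul_le_mul_of_nonneg_left hsum2 hK.le).trans hE
      refine le_trans ?_ hfin
      have e : (K : ℝ) * ((1 - ε) * ((K : ℝ)⁻¹ ^ 2 * (∑ k ∈ Finset.range K, F (k / K) - K * ε))) =
          (1 - ε) * ((K : ℝ)⁻¹ * ∑ k ∈ Finset.range K, F (k / K) - ε) := by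
        field_simp
      rw [e]
      refine mul_le_mul_of_nonneg_left ?_ (by linarith)
      linarith
    have lim : ∀ f : ℝ → ℝ, Continuous f → Tendsto f (𝓝[>] 0) (𝓝 (f 0)) := fun f hf =>
      (hf.tendsto 0).mono_left nhdsWithin_le_nhds
    have l1 := lim (fun ε => (1 - ε) * ((∫ t in (0 : ℝ)..1, F t) - 2 * ε)) (by fun_prop)
    have l2 := lim (fun ε => pathEnergy g y v' + ε) (by fun_prop)
    have := le_of_tendsto_of_tendsto l1 l2 (by
      filter_upwards [self_mem_nhdsWithin, mem_nhdsWithin_of_mem_nhds (Iio_mem_nhds one_pos)]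
        with ε h1 h2
      exact key ε h1 h2)
    simp only [sub_zero, one_mul, mul_zero, add_zero] at this
    exact this
  · simpa using hv 0 le_rfl

/-- The discrete energy of a discrete path given in the coordinates of `V`. -/
lemma discreteEnergy_coord (hw : ∀ p : V × V, W (xA + ι p.1) (xA + ι p.2) = ((w p : ℝ) : EReal))
    (K : ℕ) (u : ℕ → V) :
    discreteEnergy W (fun k : Fin (K + 1) => xA + ι (u k)) =
      ((K * ∑ k ∈ Finset.range K, w (u k, u (k + 1)) : ℝ) : EReal) := by
  have h : ∀ k : Fin K, W (xA + ι (u k.castSucc)) (xA + ι (u k.succ)) =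
      ((w (u k, u (k + 1)) : ℝ) : EReal) := fun k => hw (u k, u (k + 1))
  rw [discreteEnergy, EReal.coe_mul, Finset.sum_congr rfl fun k _ => h k,
    ← Fin.sum_univ_eq_sum_range (fun k => w (u k, u (k + 1)))]
  congr 1
  exact (map_sum (⟨⟨fun r : ℝ => (r : EReal), EReal.coe_zero⟩, EReal.coe_add⟩ : ℝ →+ EReal)
    _ _).symm

lemma IsDiscretePath.exists_coord {K : ℕ} {a b : Y} {y : Fin (K + 1) → Y}
    (hy : IsDiscretePath ι xA a b y) :
    ∃ u : ℕ → V, y = fun k : Fin (K + 1) => xA + ι (u k) := by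
  choose c hc using hy.1
  refine ⟨fun k => if h : k < K + 1 then c ⟨k, h⟩ else 0, funext fun k => ?_⟩
  simp [hc k, k.is_lt]

/-- A discrete geodesic in the coordinates of `V` is one in `Y`. -/
lemma IsDiscreteMin.isDiscreteGeodesic (hι : Function.Injective ι)
    (hw : ∀ p : V × V, W (xA + ι p.1) (xA + ι p.2) = ((w p : ℝ) : EReal)) {K : ℕ} {u : ℕ → V}
    (hu : IsDiscreteMin w K u) :
    IsDiscreteGeodesic ι xA W (xA + ι (u 0)) (xA + ι (u K))
      (fun k : Fin (K + 1) => xA + ι (u k)) := by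
  refine ⟨⟨fun k => ⟨_, rfl⟩, by simp, by simp⟩, fun y hy => ?_⟩
  obtain ⟨u', rfl⟩ := hy.exists_coord
  rw [discreteEnergy_coord hw, discreteEnergy_coord hw, EReal.coe_le_coe_iff]
  refine mul_le_mul_of_nonneg_left (hu u' ?_ ?_) (Nat.cast_nonneg K)
  · have := hy.2.1
    exact hι (by simpa using this)
  · have := hy.2.2
    exact hι (by simpa using this)

/-- For large orders, discrete geodesics exist, with velocity bounds independent of the order. -/
lemma exists_discreteMin_velocityBounds [CompleteSpace V] (hV : IsReflexive V)
    (hι : IsCompactEmbedding ι) (hg : IsAdmissibleMetric g) (hgc : Continuous g)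
    (hW : IsAdmissibleEnergy ι g xA W)
    (hw : ∀ p : V × V, W (xA + ι p.1) (xA + ι p.2) = ((w p : ℝ) : EReal))
    (hw' : IsTwoPointEnergy w) (p q : V) :
    ∃ (u : ℕ → ℕ → V) (R L : ℝ), ∀ᶠ K in atTop, u K 0 = p ∧ u K K = q ∧
      IsDiscreteMin w K (u K) ∧ HasVelocityBounds R L K (discreteVelocity K (u K)) := by
  obtain ⟨c, _, hc, hb⟩ := hg.bounds
  obtain ⟨ω, hω, hlow⟩ := hW.exists_le hg hgc hι.injective hw (half_pos one_pos)
  have hc2 : 0 < c / 2 := half_pos hc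
  have hco : LocallyCoercive w (c / 2) ω := fun p q hpq => by
    have h1 := hlow p q hpq
    have h2 := (hb (xA + ι p) (q - p)).1
    linarith
  have hseg : IsPathBetween ι (xA + ι p) (xA + ι q) (fun t => xA + ι p + t • ι (q - p))
      (fun _ => q - p) := by
    have := isPathBetween_segment (ι := ι) (xA + ι p) (q - p)
    rwa [add_assoc, ← map_add, add_sub_cancel] at this
  set E := pathEnergy g (fun t => xA + ι p + t • ι (q - p)) (fun _ => q - p) + 1 with hE
  have hE0 : 0 ≤ E := add_nonneg (hg.pathEnergy_nonneg _ _) zero_le_one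
  obtain ⟨R, L, -, hbd⟩ := hw'.exists_velocity_bounds hc2 hω hco hE0 p
  have hex : ∀ᶠ K : ℕ in atTop, ∃ u : ℕ → V, u 0 = p ∧ u K = q ∧ IsDiscreteMin w K u ∧
      HasVelocityBounds R L K (discreteVelocity K u) := by
    filter_upwards [hseg.eventually_discrete_le hg hgc hι.injective hW hw one_pos,
      (tendsto_const_div_atTop_nhds_zero_nat E).eventually_lt_const hω,
      eventually_gt_atTop 0] with K h1 h2 h3
    obtain ⟨u, hu0, huK, huE, hu⟩ := exists_isDiscreteMin hV hι hW.lsc hw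
      (R := ‖p‖ + (1 + E / (c / 2)))
      (fun u h0 _ hE k hk => h0 ▸ hco.norm_le hc2 hw'.nonneg h3 h2 hE hk) h1
    obtain ⟨h4, h5⟩ := hbd K u h3 h2 hu0 hu huE
    exact ⟨u, hu0, huK, hu, ⟨h3, h4, h5⟩⟩
  choose! u hu using fun (K : ℕ) (h : ∃ u : ℕ → V, u 0 = p ∧ u K = q ∧ IsDiscreteMin w K u ∧
      HasVelocityBounds R L K (discreteVelocity K u)) => h
  exact ⟨u, R, L, hex.mono fun K h => hu K h⟩

end

end GeodesicCalculus

open GeodesicCalculus in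
theorem theorem5p1
    {V Y : Type*} [NormedAddCommGroup V] [NormedSpace ℝ V] [CompleteSpace V]
    [TopologicalSpace.SeparableSpace V]
    [NormedAddCommGroup Y] [NormedSpace ℝ Y] [CompleteSpace Y]
    (hV : IsReflexive V)
    (ι : V →L[ℝ] Y) (hι : IsCompactEmbedding ι)
    (g : Y → V →L[ℝ] V →L[ℝ] ℝ) (hg : IsAdmissibleMetric g)
    (xA : Y) (W : Y → Y → EReal) (hW : IsAdmissibleEnergy ι g xA W)
    (hg_smooth : ContDiff ℝ 2 g)
    (hW_smooth : IsSmoothEnergy ι xA W)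
    (x xt : Y) (hx : x ∈ manifold ι xA) (hxt : xt ∈ manifold ι xA)
    (hcont : GeodesicsUnique ι g x xt)
    (hdisc : ∀ᶠ K : ℕ in atTop, DiscreteGeodesicsUnique ι xA W K x xt) :
    ∃ (ℓ : V) (L : ℕ → V),
      IsLog ι g x xt ℓ ∧
      (∀ᶠ K : ℕ in atTop, IsDiscreteLog ι xA W K x xt (L K)) ∧
      (∀ φ : StrongDual ℝ V, Tendsto (fun K : ℕ => φ ((K : ℝ) • L K)) atTop (𝓝 (φ ℓ))) ∧
      Tendsto (fun K : ℕ => ι ((K : ℝ) • L K)) atTop (𝓝 (ι ℓ)) := by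
  obtain ⟨p, rfl⟩ := hx
  obtain ⟨q, rfl⟩ := hxt
  obtain ⟨w, hw, hwC, hwb⟩ := hW_smooth
  have hgc : Continuous g := hg_smooth.continuous
  have hw' : IsTwoPointEnergy w := ⟨hwC, hwb, hW.nonneg hw, hW.self_eq_zero hg hw⟩
  obtain ⟨u, R, M, hu⟩ := exists_discreteMin_velocityBounds hV hι hg hgc hW hw hw' p q
  have hgeo := fun (U : Ultrafilter ℕ) (hU : (U : Filter ℕ) ≤ atTop) =>
    exists_isGeodesic_of_ultrafilter hV hι hg hgc hW hw hU hu
  have hder : ∀ v : ℝ → V, Continuous v →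
      HasDerivWithinAt (fun t : ℝ => ∫ s in (0 : ℝ)..t, v s) (v 0) (Icc 0 1) 0 := fun v hv =>
    (hv.integral_hasStrictDerivAt 0 0).hasDerivAt.hasDerivWithinAt
  obtain ⟨v₀, hv₀, hgeo₀, -⟩ := hgeo (Ultrafilter.of atTop) (Ultrafilter.of_le atTop)
  -- by uniqueness of the geodesic, the initial velocity is the same for all ultrafilters
  have hlim : ∀ U : Ultrafilter ℕ, (U : Filter ℕ) ≤ atTop →
      WeakTendsto (fun K => discreteVelocity K (u K) 0) U (v₀ 0) := by
    intro U hU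
    obtain ⟨v, hv, hgeoU, hvU⟩ := hgeo U hU
    have heq : ∀ t ∈ Icc (0 : ℝ) 1, ∫ s in (0 : ℝ)..t, v s = ∫ s in (0 : ℝ)..t, v₀ s :=
      fun t ht => add_left_cancel (hι.injective (add_left_cancel (hcont _ _ _ _ hgeoU hgeo₀ ht)))
    have h1 := (hder v₀ hv₀).congr heq (heq 0 (by simp))
    have h2 : v 0 = v₀ 0 :=
      (uniqueDiffOn_Icc zero_lt_one 0 (by simp)).eq_deriv _ (hder v hv) h1
    exact h2 ▸ hvU
  have hK : ∀ᶠ K : ℕ in atTop, (K : ℝ) • ((K : ℝ)⁻¹ • discreteVelocity K (u K) 0) =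
      discreteVelocity K (u K) 0 := by
    filter_upwards [eventually_gt_atTop 0] with K hK
    exact smul_inv_smul₀ (by exact_mod_cast hK.ne') _
  refine ⟨v₀ 0, fun K => (K : ℝ)⁻¹ • discreteVelocity K (u K) 0,
    ⟨hcont, _, v₀, hgeo₀, hder v₀ hv₀⟩, ?_, fun φ => ?_, ?_⟩
  · filter_upwards [hdisc, hu, eventually_gt_atTop 0] with K h1 h2 h3
    refine ⟨h1, fun k => xA + ι (u K k), ?_, ?_⟩
    · have := h2.2.2.1.isDiscreteGeodesic hι.injective hw
      rwa [h2.1, h2.2.1] at this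
    · rw [inv_smul_discreteVelocity (u K) h3, map_sub, zero_add, add_sub_add_left_eq_sub]
      have h4 : ((1 : Fin (K + 1)) : ℕ) = 1 := by
        rw [Fin.val_one', Nat.mod_eq_of_lt (by omega)]
      rw [h4, Fin.val_zero]
  · refine (tendsto_iff_ultrafilter _ _ _).2 fun U hU => ((hlim U hU) φ).congr' ?_
    filter_upwards [hU hK] with K h
    rw [h]
  · refine (tendsto_iff_ultrafilter _ _ _).2 fun U hU =>
      ((hlim U hU).tendsto_of_isCompactOperator hι.compact (R := R)
        (hU (hu.mono fun K h => h.2.2.2.norm_le 0))).congr' ?_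
    filter_upwards [hU hK] with K h
    rw [h]
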